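/- Let $S^A$ and $S^B$ be finite (possibly empty) sets, disjoint from each other and from $\{1,2\}$. Let $\mathcal X^A$ and $\mathcal X^B$ be irreducible, time-homogeneous continuous-time Markov chains with finite state spaces $V^A=S^A\cup\{1,2\}$ and $V^B=\{1,2\}\cup S^B$ and transition rate matrices $Q^A$ and $Q^B$ (so off-diagonal entries are nonnegative and $Q^\delta_{ii}=-\sum_{j\ne i}Q^\delta_{ij}$). The glued chain $\mathcal X$ has state space $S^A\cup\{1,2\}\cup S^B$ and transition rate matrix $$Q_{ij}=Q^A_{ij}\,\mathbf 1(i,j\in V^A)+Q^B_{ij}\,\mathbf 1(i,j\in V^B).$$ For $\delta\in\{A,B\}$ and $\varepsilon,\varepsilon'\in\{1,2\}$ let $\mathrm P_\varepsilon,\mathrm E_\varepsilon$ be the probability and expectation for $\mathcal X^\delta$ started from $\varepsilon$. Let $\sigma^\delta_{\varepsilon'}$ be the first hitting time of $\varepsilon'$ after leaving the initial state, that is, $\sigma^\delta_{\varepsilon'}=\inf\{t>0:\mathcal X^\delta_t=\varepsilon',\ \exists u\in(0,t)\ \mathcal X^\delta_u\ne\varepsilon'\}$ if $\mathcal X^\delta_0=\varepsilon'$,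 and $\sigma^\delta_{\varepsilon'}=\inf\{t>0:\mathcal X^\delta_t=\varepsilon'\}$ otherwise. For $k\in S^\delta$ let $\chi^\delta_{\varepsilon'}(k)=\int_0^{\sigma^\delta_{\varepsilon'}}\mathbf 1(\mathcal X^\delta_t=k)\,dt$. Put $$q^\delta_{\varepsilon\delta\varepsilon'}=\Big(\sum_{j\ne\varepsilon}Q^\delta_{\varepsilon j}\Big)\,\mathrm P_\varepsilon\big(\sigma^\delta_{\varepsilon'}<\sigma^\delta_{3-\varepsilon'}\big),\qquad \mathrm E_{\varepsilon\varepsilon'}[\chi^\delta_{\varepsilon'}(k)]=\frac{\mathrm E_\varepsilon\big[\chi^\delta_{\varepsilon'}(k)\mathbf 1(\sigma^\delta_{\varepsilon'}<\sigma^\delta_{3-\varepsilon'})\big]}{\mathrm P_\varepsilon\big(\sigma^\delta_{\varepsilon'}<\sigma^\delta_{3-\varepsilon'}\big)},$$ where the latter is set to $0$ if the denominator is $0$. For $i\in S^A$ and $j\in S^B$ define \begin{align*} v_i&=q^A_{1A1}\mathrm E_{11}[\chi^A_1(i)]+q^A_{1A2}\mathrm E_{12}[\chi^A_2(i)], & w_i&=q^A_{2A2}\mathrm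 E_{22}[\chi^A_2(i)]+q^A_{2A1}\mathrm E_{21}[\chi^A_1(i)],\\ x_j&=q^B_{1B1}\mathrm E_{11}[\chi^B_1(j)]+q^B_{1B2}\mathrm E_{12}[\chi^B_2(j)], & y_j&=q^B_{2B2}\mathrm E_{22}[\chi^B_2(j)]+q^B_{2B1}\mathrm E_{21}[\chi^B_1(j)]. \end{align*} Then all these conditional expectations are finite, and the glued chain has exactly one stationary distribution $\pi$ (a probability vector with $\pi^{\mathrm T}Q=0$). It is the unique real vector that solves the linear system \begin{align*} \pi_i&=\pi_1v_i+\pi_2w_i\quad(i\in S^A), & \pi_j&=\pi_1x_j+\pi_2y_j\quad(j\in S^B),\\ (q^A_{1A2}+q^B_{1B2})\,\pi_1&=(q^A_{2A1}+q^B_{2B1})\,\pi_2, & \sum_{k\in S^A\cup\{1,2\}\cup S^B}\pi_k&=1. \end{align*} Specifically, with $$D=(q^A_{2A1}+q^B_{2B1})\Big(\sum_{i}v_i+\sum_{j}x_j+1\Big)+(q^A_{1A2}+q^B_{1B2})\Big(\sum_{i}w_i+\sum_{j}y_j+1\Big)>0,$$ one has $$\pi_1=\frac{q^A_{2A1}+q^B_{2B1}}{D},\qquad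 \pi_2=\frac{q^A_{1A2}+q^B_{1B2}}{D}.$$ -/

import Mathlib

open MeasureTheory ProbabilityTheory
open scoped ENNReal

noncomputable section

namespace MarkovGluing

instance {α β : Type*} [MeasurableSpace α] [MeasurableSpace β] [MeasurableSingletonClass α]
    [MeasurableSingletonClass β] : MeasurableSingletonClass (α ⊕ β) := by
  refine ⟨fun x => ?_⟩
  rcases x with a | b
  · rw [← Set.image_singleton]
    exact measurableSet_inl_image.2 (measurableSet_singleton a)
  · rw [← Set.image_singleton]
    exact measurableSet_inr_image.2 (measurableSet_singleton b)

section Chain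

variable {V : Type*} [Fintype V] [DecidableEq V]

/-- `Q` is a transition rate matrix: nonnegative off-diagonal entries and
`Q i i = -∑_{j ≠ i} Q i j`. -/
structure IsRateMatrix (Q : Matrix V V ℝ) : Prop where
  offDiag_nonneg : ∀ i j, i ≠ j → 0 ≤ Q i j
  diag_eq : ∀ i, Q i i = -∑ j ∈ Finset.univ.erase i, Q i j

/-- Irreducibility: every state can be reached from every state along transitions with positive
rates. -/
def IsIrreducible (Q : Matrix V V ℝ) : Prop :=
  ∀ i j, Relation.ReflTransGen (fun a b => a ≠ b ∧ 0 < Q a b) i j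

/-- `π` is a stationary distribution of the chain with rate matrix `Q`: a probability vector with
`πᵀ Q = 0`. -/
structure IsStationaryDistribution (Q : Matrix V V ℝ) (π : V → ℝ) : Prop where
  nonneg : ∀ i, 0 ≤ π i
  sum_eq_one : ∑ i, π i = 1
  vecMul_eq_zero : Matrix.vecMul π Q = 0

/-- The total rate of leaving the state `i`. -/
def exitRate (Q : Matrix V V ℝ) (i : V) : ℝ := ∑ j ∈ Finset.univ.erase i, Q i j

/-- The rates of the transitions out of `i`, as weights. -/
def jumpWeight (Q : Matrix V V ℝ) (i j : V) : ℝ≥0∞ := if i = j then 0 else ENNReal.ofReal (Q i j)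

theorem tsum_jumpWeight_ne_top (Q : Matrix V V ℝ) (i : V) : ∑' j, jumpWeight Q i j ≠ ∞ := by
  rw [tsum_fintype]
  refine ENNReal.sum_ne_top.2 fun j _ => ?_
  unfold jumpWeight
  split_ifs <;> simp

open Classical in
/-- The law of the next state visited after `i`: the state `j ≠ i` has probability
`Q i j / exitRate Q i`. If no transition leaves `i`, the jump chain stays in `i`. -/
def jumpLaw (Q : Matrix V V ℝ) (i : V) : PMF V :=
  if h : ∑' j, jumpWeight Q i j = 0 then PMF.pure i
  else PMF.normalize (jumpWeight Q i) h (tsum_jumpWeight_ne_top Q i)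

variable [MeasurableSpace V] [MeasurableSingletonClass V]

/-- The transition kernel of the jump chain. -/
def jumpKernel (Q : Matrix V V ℝ) : Kernel V V :=
  Kernel.ofFunOfCountable fun i => (jumpLaw Q i).toMeasure

instance (Q : Matrix V V ℝ) : IsMarkovKernel (jumpKernel Q) :=
  ⟨fun i => inferInstanceAs (IsProbabilityMeasure (jumpLaw Q i).toMeasure)⟩

/-- The jump kernel seen as a kernel from the history up to step `n` to the state at step
`n + 1`. -/
def historyKernel (Q : Matrix V V ℝ) (n : ℕ) : Kernel (Finset.Iic n → V) V :=
  (jumpKernel Q).comap (fun h => h ⟨n, Finset.mem_Iic.2 le_rfl⟩) (measurable_pi_apply _)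

instance (Q : Matrix V V ℝ) (n : ℕ) : IsMarkovKernel (historyKernel Q n) := by
  unfold historyKernel
  infer_instance

/-- The law of the jump chain (the sequence of states visited) started from `i`. -/
def jumpChainLaw (Q : Matrix V V ℝ) (i : V) : Measure (ℕ → V) :=
  Kernel.trajMeasure (X := fun _ => V) (Measure.dirac i) (historyKernel Q)

/-- The probability space of the canonical construction of the continuous-time Markov chain: the
first component is the jump chain, the second one an independent sequence of independent
exponential clocks of rate one. `chainLaw Q i` is the law `P_i` of the chain started from `i`. -/
def chainLaw (Q : Matrix V V ℝ) (i : V) : Measure ((ℕ → V) × (ℕ → ℝ)) :=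
  (jumpChainLaw Q i).prod (Measure.infinitePi fun _ : ℕ => expMeasure 1)

/-- The time spent in the `n`-th visited state: an exponential variable whose rate is the exit rate
of that state. -/
def holdingTime (Q : Matrix V V ℝ) (ω : (ℕ → V) × (ℕ → ℝ)) (n : ℕ) : ℝ≥0∞ :=
  ENNReal.ofReal (ω.2 n) / ENNReal.ofReal (exitRate Q (ω.1 n))

/-- The time of the `n`-th jump (with `jumpTime Q ω 0 = 0`). -/
def jumpTime (Q : Matrix V V ℝ) (ω : (ℕ → V) × (ℕ → ℝ)) (n : ℕ) : ℝ≥0∞ :=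
  ∑ m ∈ Finset.range n, holdingTime Q ω m

open Classical in
/-- The state `X_t` of the continuous-time Markov chain at time `t ≥ 0`: the `n`-th visited state,
if `t` lies between the `n`-th and the `(n + 1)`-st jump (there is such an `n` almost surely). -/
def chain (Q : Matrix V V ℝ) (ω : (ℕ → V) × (ℕ → ℝ)) (t : ℝ) : V :=
  if h : ∃ n, ENNReal.ofReal t < jumpTime Q ω (n + 1) then ω.1 (Nat.find h) else ω.1 0

end Chain

section Excursions

variable {V : Type*}

open Classical in
/-- The first hitting time `σ_e` of the state `e` by the path `X` after leaving the initial state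
(`∞` if there is none). -/
def hitTime (X : ℝ → V) (e : V) : ℝ≥0∞ :=
  if X 0 = e then
    ⨅ (t : ℝ) (_ : 0 < t ∧ (∃ u, 0 < u ∧ u < t ∧ X u ≠ e) ∧ X t = e), ENNReal.ofReal t
  else
    ⨅ (t : ℝ) (_ : 0 < t ∧ X t = e), ENNReal.ofReal t

/-- The time `χ_e(k)` that the path `X` spends in the state `k` before the time `σ_e`. -/
def occupationTime (X : ℝ → V) (e k : V) : ℝ≥0∞ :=
  ∫⁻ t in {t : ℝ | 0 ≤ t ∧ ENNReal.ofReal t < hitTime X e}, {t : ℝ | X t = k}.indicator 1 t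

variable [Fintype V] [DecidableEq V] [MeasurableSpace V] [MeasurableSingletonClass V]

/-- The event that an excursion of the chain ends in `g ε'`, where `g 0`, `g 1` are the two
distinguished states: `σ_{ε'} < σ_{3 - ε'}` when the states are called `1`, `2`. -/
def endsIn (Q : Matrix V V ℝ) (g : Fin 2 → V) (ε' : Fin 2) : Set ((ℕ → V) × (ℕ → ℝ)) :=
  {ω | hitTime (chain Q ω) (g ε') < hitTime (chain Q ω) (g (1 - ε'))}

/-- The probability that an excursion of the chain from `g ε` ends in `g ε'`. -/
def excursionProb (Q : Matrix V V ℝ) (g : Fin 2 → V) (ε ε' : Fin 2) : ℝ≥0∞ :=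
  chainLaw Q (g ε) (endsIn Q g ε')

/-- The intensity of leaving `g ε` on an excursion that ends in `g ε'`. -/
def excursionRate (Q : Matrix V V ℝ) (g : Fin 2 → V) (ε ε' : Fin 2) : ℝ :=
  exitRate Q (g ε) * (excursionProb Q g ε ε').toReal

/-- The conditional expectation `E_ε[χ_{ε'}(k) | σ_{ε'} < σ_{3 - ε'}]` of the time spent in `k` on
an excursion from `g ε`, given that it ends in `g ε'`; zero if the condition has probability
zero. -/
def condOccupation (Q : Matrix V V ℝ) (g : Fin 2 → V) (ε ε' : Fin 2) (k : V) : ℝ≥0∞ :=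
  if excursionProb Q g ε ε' ≠ 0 then
    (∫⁻ ω, (endsIn Q g ε').indicator (fun ω => occupationTime (chain Q ω) (g ε') k) ω
      ∂chainLaw Q (g ε)) / excursionProb Q g ε ε'
  else 0

/-- The coefficient of the stationary weight of the distinguished state `g ε` in the formula for
the state `k`: sum over the two end points of the intensity of the excursion times the conditional
expected time that it spends in `k`. -/
def excursionWeight (Q : Matrix V V ℝ) (g : Fin 2 → V) (ε : Fin 2) (k : V) : ℝ :=
  excursionRate Q g ε ε * (condOccupation Q g ε ε k).toReal
    + excursionRate Q g ε (1 - ε) * (condOccupation Q g ε (1 - ε) k).toReal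

end Excursions

section Glue

variable {SA SB : Type*}

/-- The glued rate matrix. The state spaces of the two chains are `SA ⊕ Fin 2` and `Fin 2 ⊕ SB`,
where the elements `0`, `1` of `Fin 2` stand for the shared states `1`, `2`; the glued chain lives
on `SA ⊕ Fin 2 ⊕ SB`. All rates of either chain are kept, and they are added where both are
present. -/
def glue (QA : Matrix (SA ⊕ Fin 2) (SA ⊕ Fin 2) ℝ) (QB : Matrix (Fin 2 ⊕ SB) (Fin 2 ⊕ SB) ℝ) :
    Matrix (SA ⊕ Fin 2 ⊕ SB) (SA ⊕ Fin 2 ⊕ SB) ℝ :=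
  Matrix.reindex (Equiv.sumAssoc SA (Fin 2) SB) (Equiv.sumAssoc SA (Fin 2) SB)
      (Matrix.fromBlocks QA 0 0 0)
    + Matrix.fromBlocks 0 0 0 QB

end Glue

end MarkovGluing

end

/-!
Let `g 0`, `g 1` be the two distinguished states of an irreducible chain with rate matrix `Q`, and
let `u_ε` be the vector of all `excursionWeight Q g ε k`, for `k` in the whole state space. It is
the measure of mean occupation times of an excursion from `g ε`, normalized to the value `1` at
`g ε` and `0` at the other distinguished state. The theorem rests on one identity: `u_ε Q` vanishes
off the distinguished states, and its entries there are `-q` at `g ε` and `q` at `g (1 - ε)`, where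
`q = excursionRate Q g ε (1 - ε)` (`vecMul_excursionWeight_of_notMem`,
`vecMul_excursionWeight_apply`).

For this identity, almost every path is a step function whose excursion ends at a jump
`n + 1`, so that the hitting time is a jump time and the occupation time of `k` is a sum of holding
times (`hitTime_eq_jumpTime`, `occupationTime_eq_sum`). The clocks are independent of the jump chain
and have mean one, so the expected occupation time, added over both end points, is
`green Q T (g ε) k / exitRate Q k`, where `green` counts the expected visits of the jump chain
before it enters `T = Set.range g` (`lintegral_visitTime`, `excursionTime_add`). The Markov property
of the jump chain gives the recursion `green_of_notMem` and the hitting probabilities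
`excursionProb_eq`; both are translated into the identity for `u_ε Q` by
`exitRate Q j * jumpLaw Q j k = Q j k`. The Green function is finite because the Dirichlet problem
`Q f = -exitRate` off `T`, `f = 0` on `T` has a nonnegative solution
(`tsum_sum_killedProb_ne_top`), by the maximum principle.

The maximum principle also shows that a vector that is annihilated by `Q` off `T` and vanishes on
`T` is zero, hence every vector that is annihilated by `Q` off `T` is the combination of `u_0` and
`u_1` with its values at `g 0` and `g 1` (`eq_excursionWeight_iff`). Applied to the restrictions of a
vector `ρ` to the two parts of the glued chain, this turns `ρ Q = 0` into the linear system: the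
columns outside the shared states give the formulas for the weights there, and the two columns of
the shared states both give the balance equation, since the flows of the two chains add up. The
rates `excursionRate Q g ε (1 - ε)` are positive (`excursionRate_pos`), so the normalized system has
exactly one solution, and this solution is nonnegative.
-/

namespace MarkovGluing

/-! ### The jump chain -/

/-- The event that the states visited at the steps `1, …, n` lie outside `T`. -/
def avoids {V : Type*} (T : Set V) (n : ℕ) : Set (ℕ → V) := {x | ∀ m, 0 < m → m ≤ n → x m ∉ T}

theorem measurableSet_coord {V : Type*} [MeasurableSpace V]
    [MeasurableSingletonClass V] (n : ℕ) (k : V) : MeasurableSet {x : ℕ → V | x n = k} := by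
  have h : Measurable fun x : ℕ → V => x n := measurable_pi_apply n
  exact h (measurableSet_singleton k)

theorem measurableSet_avoids {V : Type*} [Finite V] [MeasurableSpace V]
    [MeasurableSingletonClass V] (T : Set V) (n : ℕ) : MeasurableSet (avoids T n) := by
  have : avoids T n = ⋂ m, ⋂ (_ : 0 < m), ⋂ (_ : m ≤ n), (fun x : ℕ → V => x m) ⁻¹' Tᶜ := by
    ext x; simp [avoids]
  rw [this]
  exact MeasurableSet.iInter fun m => MeasurableSet.iInter fun _ => MeasurableSet.iInter fun _ =>
    measurable_pi_apply m (Set.to_countable _).measurableSet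

theorem measurableSet_killed {V : Type*} [Finite V] [MeasurableSpace V]
    [MeasurableSingletonClass V] (T : Set V) (n : ℕ) (k : V) :
    MeasurableSet {x : ℕ → V | x ∈ avoids T n ∧ x n = k} :=
  (measurableSet_avoids T n).inter (measurableSet_coord n k)

section JumpChain

variable {V : Type*} [Fintype V] [DecidableEq V] {Q : Matrix V V ℝ}

theorem IsRateMatrix.exitRate_eq (hQ : IsRateMatrix Q) (i : V) : exitRate Q i = -Q i i := by
  rw [hQ.diag_eq, neg_neg, exitRate]

theorem IsRateMatrix.exitRate_nonneg (hQ : IsRateMatrix Q) (i : V) : 0 ≤ exitRate Q i :=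
  Finset.sum_nonneg fun _ hj => hQ.offDiag_nonneg _ _ (Finset.ne_of_mem_erase hj).symm

theorem IsRateMatrix.row_sum (hQ : IsRateMatrix Q) (i : V) : ∑ j, Q i j = 0 := by
  rw [← Finset.add_sum_erase _ _ (Finset.mem_univ i), hQ.diag_eq, neg_add_cancel]

theorem IsRateMatrix.tsum_jumpWeight (hQ : IsRateMatrix Q) (i : V) :
    ∑' j, jumpWeight Q i j = ENNReal.ofReal (exitRate Q i) := by
  rw [tsum_fintype, exitRate, ENNReal.ofReal_sum_of_nonneg fun j hj =>
    hQ.offDiag_nonneg _ _ (Finset.ne_of_mem_erase hj).symm,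
    ← Finset.add_sum_erase _ _ (Finset.mem_univ i)]
  simp only [jumpWeight, if_true, zero_add]
  refine Finset.sum_congr rfl fun j hj => ?_
  rw [if_neg (Finset.ne_of_mem_erase hj).symm]

theorem IsRateMatrix.jumpLaw_apply (hQ : IsRateMatrix Q) {i : V} (hi : 0 < exitRate Q i) (j : V) :
    jumpLaw Q i j = jumpWeight Q i j / ENNReal.ofReal (exitRate Q i) := by
  have h : ∑' j, jumpWeight Q i j ≠ 0 := by
    rw [hQ.tsum_jumpWeight]; simpa using hi
  rw [jumpLaw, dif_neg h, PMF.normalize_apply, hQ.tsum_jumpWeight, div_eq_mul_inv]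

theorem IsRateMatrix.jumpLaw_self (hQ : IsRateMatrix Q) {i : V} (hi : 0 < exitRate Q i) :
    jumpLaw Q i i = 0 := by
  simp [hQ.jumpLaw_apply hi, jumpWeight]

theorem IsRateMatrix.exitRate_mul_jumpLaw (hQ : IsRateMatrix Q) {i : V} (hi : 0 < exitRate Q i)
    {j : V} (hij : i ≠ j) : exitRate Q i * (jumpLaw Q i j).toReal = Q i j := by
  rw [hQ.jumpLaw_apply hi, jumpWeight, if_neg hij, ENNReal.toReal_div,
    ENNReal.toReal_ofReal (hQ.offDiag_nonneg _ _ hij), ENNReal.toReal_ofReal hi.le]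
  field_simp

variable [MeasurableSpace V] [MeasurableSingletonClass V]

instance (Q : Matrix V V ℝ) (i : V) : IsProbabilityMeasure (jumpChainLaw Q i) := by
  unfold jumpChainLaw
  infer_instance

theorem jumpChainLaw_ae_zero (Q : Matrix V V ℝ) (i : V) : ∀ᵐ x ∂jumpChainLaw Q i, x 0 = i := by
  have h : (jumpChainLaw Q i).map (Preorder.frestrictLe (π := fun _ => V) 0) =
      (Measure.dirac i).map (MeasurableEquiv.piUnique fun _ : Finset.Iic 0 => V).symm := by
    rw [jumpChainLaw, Kernel.trajMeasure, Measure.map_comp _ _ (by fun_prop),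
      Kernel.traj_map_frestrictLe, Kernel.partialTraj_self, Measure.id_comp]
  have h2 : ∀ᵐ y ∂(jumpChainLaw Q i).map (Preorder.frestrictLe (π := fun _ => V) 0),
      y ⟨0, by simp⟩ = i := by
    rw [h, ae_map_iff (MeasurableEquiv.measurable _).aemeasurable
      (Set.to_countable _).measurableSet, ae_dirac_eq]
    rfl
  exact ae_of_ae_map (by fun_prop) h2

/-- The Markov property of the jump chain: given a past up to step `n` that ends in `j`, the next
state is distributed according to `jumpLaw Q j`. -/
theorem jumpChainLaw_step (Q : Matrix V V ℝ) (i : V) (n : ℕ) (B : Set (Finset.Iic n → V))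
    (j k : V) :
    jumpChainLaw Q i {x | (Preorder.frestrictLe (π := fun _ => V) n x ∈ B ∧ x n = j) ∧
      x (n + 1) = k} =
    jumpChainLaw Q i {x | Preorder.frestrictLe (π := fun _ => V) n x ∈ B ∧ x n = j} *
      jumpLaw Q j k := by
  set μ := jumpChainLaw Q i
  have key := Kernel.map_frestrictLe_trajMeasure_compProd_eq_map_trajMeasure (X := fun _ => V)
    (κ := historyKernel Q) (μ₀ := Measure.dirac i) (a := n)
  change μ.map _ ⊗ₘ _ = μ.map _ at key
  set C : Set (Finset.Iic n → V) := {h | h ∈ B ∧ h ⟨n, by simp⟩ = j}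
  have hC : MeasurableSet C := C.to_countable.measurableSet
  have h1 := congrArg (fun ν => ν (C ×ˢ {k})) key
  beta_reduce at h1
  rw [Measure.compProd_apply_prod hC (measurableSet_singleton k),
    Measure.map_apply (by fun_prop) (hC.prod (measurableSet_singleton k))] at h1
  have h2 : ∫⁻ h in C, historyKernel Q n h {k} ∂μ.map (Preorder.frestrictLe n) =
      ∫⁻ h in C, jumpLaw Q j k ∂μ.map (Preorder.frestrictLe n) := by
    refine setLIntegral_congr_fun hC fun h hh => ?_
    have : h ⟨n, Finset.mem_Iic.2 le_rfl⟩ = j := hh.2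
    simp only [historyKernel, Kernel.comap_apply, this]
    exact (jumpLaw Q j).toMeasure_apply_singleton k (measurableSet_singleton k)
  rw [h2, setLIntegral_const, Measure.map_apply (by fun_prop) hC, mul_comm] at h1
  exact h1.symm

/-- The probability that the jump chain from `i` is in `k` at step `n`, and has not been in `T` at
the steps `1, …, n`. -/
noncomputable def killedProb (Q : Matrix V V ℝ) (T : Set V) (i : V) (n : ℕ) (k : V) : ℝ≥0∞ :=
  jumpChainLaw Q i {x | x ∈ avoids T n ∧ x n = k}

theorem killedProb_zero (Q : Matrix V V ℝ) (T : Set V) (i k : V) :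
    killedProb Q T i 0 k = if k = i then 1 else 0 := by
  have h : {x : ℕ → V | x ∈ avoids T 0 ∧ x 0 = k} =ᵐ[jumpChainLaw Q i]
      (if k = i then Set.univ else ∅ : Set (ℕ → V)) := by
    filter_upwards [jumpChainLaw_ae_zero Q i] with x hx
    apply propext
    change (x ∈ avoids T 0 ∧ x 0 = k) ↔ x ∈ (if k = i then Set.univ else ∅ : Set (ℕ → V))
    have : x ∈ avoids T 0 := fun m hm hm0 => absurd hm (by omega)
    split_ifs with hk
    · simp [this, hx, hk]
    · simp [hx, Ne.symm hk]
  rw [killedProb, measure_congr h]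
  split_ifs <;> simp

theorem killedProb_of_mem (Q : Matrix V V ℝ) {T : Set V} (i : V) (n : ℕ) {k : V} (hk : k ∈ T) :
    killedProb Q T i (n + 1) k = 0 := by
  rw [killedProb]
  convert measure_empty (μ := jumpChainLaw Q i)
  ext x
  simp only [Set.mem_ofPred_eq, Set.mem_empty_iff_false, iff_false, not_and]
  exact fun h he => h (n + 1) n.succ_pos le_rfl (he ▸ hk)

theorem jumpChainLaw_avoids_succ (Q : Matrix V V ℝ) (T : Set V) (i : V) (n : ℕ) (k : V) :
    jumpChainLaw Q i {x | x ∈ avoids T n ∧ x (n + 1) = k} =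
      ∑ j, killedProb Q T i n j * jumpLaw Q j k := by
  have h : {x : ℕ → V | x ∈ avoids T n ∧ x (n + 1) = k} =
      ⋃ j ∈ (Finset.univ : Finset V), {x | (x ∈ avoids T n ∧ x n = j) ∧ x (n + 1) = k} := by
    ext x; simp
  rw [h, measure_biUnion_finset]
  · refine Finset.sum_congr rfl fun j _ => ?_
    have e : ∀ x : ℕ → V, x ∈ avoids T n ↔ Preorder.frestrictLe (π := fun _ => V) n x ∈
        {h : Finset.Iic n → V | ∀ m : Finset.Iic n, 0 < (m : ℕ) → h m ∉ T} := by
      intro x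
      simp only [avoids, Set.mem_ofPred_eq, Preorder.frestrictLe_apply, Subtype.forall,
        Finset.mem_Iic]
      exact ⟨fun H m h1 h2 => H m h2 h1, fun H m h1 h2 => H m h2 h1⟩
    simp only [killedProb, e]
    exact jumpChainLaw_step Q i n _ j k
  · intro a _ b _ hab
    refine Set.disjoint_left.2 fun x hx hx' => hab ?_
    exact hx.1.2.symm.trans hx'.1.2
  · exact fun j _ => (measurableSet_killed T n j).inter (measurableSet_coord _ k)

theorem killedProb_succ (Q : Matrix V V ℝ) {T : Set V} (i : V) (n : ℕ) {k : V} (hk : k ∉ T) :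
    killedProb Q T i (n + 1) k = ∑ j, killedProb Q T i n j * jumpLaw Q j k := by
  rw [← jumpChainLaw_avoids_succ, killedProb]
  congr 1
  ext x
  refine and_congr_left fun hx => ⟨fun h m h1 h2 => h m h1 (by omega), fun h m h1 h2 => ?_⟩
  rcases Nat.lt_or_ge n m with h3 | h3
  · obtain rfl : m = n + 1 := by omega
    rwa [hx]
  · exact h m h1 h3

/-- The jump chain never stays where it is, if all exit rates are positive. -/
theorem jumpChainLaw_ae_ne (hQ : IsRateMatrix Q) (hpos : ∀ i, 0 < exitRate Q i) (i : V) :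
    ∀ᵐ x ∂jumpChainLaw Q i, x 1 ≠ x 0 := by
  have h : jumpChainLaw Q i {x | x ∈ avoids ∅ 0 ∧ x 1 = i} = 0 := by
    rw [jumpChainLaw_avoids_succ]
    refine Finset.sum_eq_zero fun j _ => ?_
    rw [killedProb_zero]
    split_ifs with hj
    · rw [hj, hQ.jumpLaw_self (hpos i), mul_zero]
    · rw [zero_mul]
  have h' : ∀ᵐ x ∂jumpChainLaw Q i, ¬ (x ∈ avoids ∅ 0 ∧ x 1 = i) := by
    rw [ae_iff]; simpa using h
  filter_upwards [h', jumpChainLaw_ae_zero Q i] with x hx hx0 h1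
  exact hx ⟨fun m hm hm' => absurd hm (by omega), h1.trans hx0⟩

end JumpChain

/-! ### Exponential clocks -/

section Clocks

/-- The mean of an exponential clock of rate one, in the form `x * gammaPDF 1 1 x = gammaPDF 2 1 x`.
-/
theorem lintegral_ofReal_expMeasure : ∫⁻ x, ENNReal.ofReal x ∂expMeasure 1 = 1 := by
  have hm : Measurable (gammaPDF 1 1) := (measurable_gammaPDFReal 1 1).ennreal_ofReal
  rw [expMeasure, gammaMeasure, lintegral_withDensity_eq_lintegral_mul _ hm (by fun_prop)]
  rw [← lintegral_gammaPDF_eq_one (a := 2) (r := 1) (by norm_num) one_pos]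
  congr 1
  ext x
  simp only [Pi.mul_apply, gammaPDF, gammaPDFReal]
  split_ifs with hx
  · rw [← ENNReal.ofReal_mul (by positivity)]
    norm_num [Real.Gamma_two]
    rw [mul_comm]
  · simp

instance : IsProbabilityMeasure (expMeasure 1) := isProbabilityMeasure_expMeasure one_pos

theorem expMeasure_ae_pos : ∀ᵐ x ∂expMeasure 1, 0 < x := by
  rw [ae_iff]
  have : {a : ℝ | ¬ 0 < a} = Set.Iic 0 := by ext; simp
  rw [this, expMeasure, gammaMeasure, withDensity_apply _ measurableSet_Iic,
    setLIntegral_congr Iio_ae_eq_Iic.symm, lintegral_gammaPDF_of_nonpos le_rfl]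

end Clocks

/-! ### Hitting and occupation times along a path -/

section Paths

variable {V : Type*} [Fintype V] [DecidableEq V] {Q : Matrix V V ℝ} {ω : (ℕ → V) × (ℕ → ℝ)}

theorem holdingTime_ne_top (hpos : ∀ i, 0 < exitRate Q i) (n : ℕ) : holdingTime Q ω n ≠ ∞ :=
  ENNReal.div_ne_top ENNReal.ofReal_ne_top (by simpa using hpos _)

theorem holdingTime_ne_zero (hω : ∀ n, 0 < ω.2 n) (n : ℕ) : holdingTime Q ω n ≠ 0 := by
  simp [holdingTime, ENNReal.div_eq_zero_iff, hω n]

theorem jumpTime_succ (n : ℕ) :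
    jumpTime Q ω (n + 1) = jumpTime Q ω n + holdingTime Q ω n :=
  Finset.sum_range_succ _ _

theorem jumpTime_ne_top (hpos : ∀ i, 0 < exitRate Q i) (n : ℕ) : jumpTime Q ω n ≠ ∞ :=
  ENNReal.sum_ne_top.2 fun _ _ => holdingTime_ne_top hpos _

theorem jumpTime_strictMono (hpos : ∀ i, 0 < exitRate Q i) (hω : ∀ n, 0 < ω.2 n) :
    StrictMono (jumpTime Q ω) := by
  refine strictMono_nat_of_lt_succ fun n => ?_
  rw [jumpTime_succ]
  exact ENNReal.lt_add_right (jumpTime_ne_top hpos n) (holdingTime_ne_zero hω n)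

theorem jumpTime_mono : Monotone (jumpTime Q ω) :=
  monotone_nat_of_le_succ fun n => by rw [jumpTime_succ]; exact le_self_add

theorem chain_eq {n : ℕ} {t : ℝ} (h1 : jumpTime Q ω n ≤ ENNReal.ofReal t)
    (h2 : ENNReal.ofReal t < jumpTime Q ω (n + 1)) : chain Q ω t = ω.1 n := by
  classical
  have h : ∃ n, ENNReal.ofReal t < jumpTime Q ω (n + 1) := ⟨n, h2⟩
  rw [chain, dif_pos h]
  exact congrArg ω.1 ((Nat.find_eq_iff h).2
    ⟨h2, fun m hm => not_lt.2 ((jumpTime_mono hm).trans h1)⟩)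

theorem exists_jumpTime_le_lt {N : ℕ} {t : ℝ} (h : ENNReal.ofReal t < jumpTime Q ω N) :
    ∃ m < N, jumpTime Q ω m ≤ ENNReal.ofReal t ∧ ENNReal.ofReal t < jumpTime Q ω (m + 1) := by
  induction N with
  | zero => simp [jumpTime] at h
  | succ N ih =>
    rcases lt_or_ge (ENNReal.ofReal t) (jumpTime Q ω N) with h1 | h1
    · obtain ⟨m, hm, h2⟩ := ih h1
      exact ⟨m, by omega, h2⟩
    · exact ⟨N, by omega, h1, h⟩

theorem chain_jumpTime (hpos : ∀ i, 0 < exitRate Q i) (hω : ∀ n, 0 < ω.2 n) (n : ℕ) :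
    chain Q ω (jumpTime Q ω n).toReal = ω.1 n := by
  have h := ENNReal.ofReal_toReal (jumpTime_ne_top (ω := ω) hpos n)
  exact chain_eq h.ge (h.trans_lt (jumpTime_strictMono hpos hω n.lt_succ_self))

theorem chain_zero (hpos : ∀ i, 0 < exitRate Q i) (hω : ∀ n, 0 < ω.2 n) :
    chain Q ω 0 = ω.1 0 := by
  simpa [jumpTime] using chain_jumpTime (Q := Q) hpos hω 0

/-- The default value that `chain` takes after an accumulation point of the jump times plays no role
here, since only times before the `N`-th jump matter. -/
theorem jumpTime_le_hitTime (hpos : ∀ i, 0 < exitRate Q i) (hω : ∀ n, 0 < ω.2 n) {e : V} {N : ℕ}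
    (hN : ∀ m, 0 < m → m < N → ω.1 m ≠ e) : jumpTime Q ω N ≤ hitTime (chain Q ω) e := by
  have key : ∀ t, chain Q ω t = e → ENNReal.ofReal t < jumpTime Q ω N →
      ENNReal.ofReal t < jumpTime Q ω 1 ∧ ω.1 0 = e := by
    intro t ht h
    obtain ⟨m, hm, h1, h2⟩ := exists_jumpTime_le_lt h
    rw [chain_eq h1 h2] at ht
    rcases Nat.eq_zero_or_pos m with rfl | h0
    · exact ⟨h2, ht⟩
    · exact absurd ht (hN m h0 hm)
  rw [hitTime, chain_zero hpos hω]
  split_ifs with h0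
  · refine le_iInf₂ fun t ht => not_lt.1 fun h => ?_
    obtain ⟨h3, -⟩ := key t ht.2.2 h
    obtain ⟨u, hu0, hut, hu⟩ := ht.2.1
    refine hu ((chain_eq (n := 0) (by simp [jumpTime]) ?_).trans h0)
    exact (ENNReal.ofReal_le_ofReal hut.le).trans_lt h3
  · exact le_iInf₂ fun t ht => not_lt.1 fun h => h0 (key t ht.2 h).2

/-- The hypothesis `hne` provides the time at which the path has left its initial state, which the
definition of `hitTime` requires when `e` is this state. -/
theorem hitTime_eq_jumpTime (hpos : ∀ i, 0 < exitRate Q i) (hω : ∀ n, 0 < ω.2 n)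
    (hne : ω.1 1 ≠ ω.1 0) {e : V} {N : ℕ} (hN0 : 0 < N) (hNe : ω.1 N = e)
    (hN : ∀ m, 0 < m → m < N → ω.1 m ≠ e) : hitTime (chain Q ω) e = jumpTime Q ω N := by
  refine le_antisymm ?_ (jumpTime_le_hitTime hpos hω hN)
  have hs := jumpTime_strictMono hpos hω (Q := Q)
  have hr : ∀ {m n}, m < n → (jumpTime Q ω m).toReal < (jumpTime Q ω n).toReal := fun h =>
    (ENNReal.toReal_lt_toReal (jumpTime_ne_top hpos _) (jumpTime_ne_top hpos _)).2 (hs h)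
  have hz : (jumpTime Q ω 0).toReal = 0 := by simp [jumpTime]
  have hX := (chain_jumpTime hpos hω N).trans hNe
  rw [← ENNReal.ofReal_toReal (jumpTime_ne_top (ω := ω) hpos N), hitTime, chain_zero hpos hω]
  split_ifs with h0
  · have h1 : 1 < N := by
      refine lt_of_le_of_ne hN0 fun h => hne ?_
      rw [h, hNe, h0]
    refine iInf₂_le _ ⟨hz ▸ hr hN0, ⟨(jumpTime Q ω 1).toReal, hz ▸ hr one_pos, hr h1, ?_⟩, hX⟩
    rw [chain_jumpTime hpos hω, ← h0]
    exact hne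
  · exact iInf₂_le _ ⟨hz ▸ hr hN0, hX⟩

theorem occupationTime_eq_sum (hpos : ∀ i, 0 < exitRate Q i) {e : V} {N : ℕ}
    (hN : hitTime (chain Q ω) e = jumpTime Q ω N) (k : V) :
    occupationTime (chain Q ω) e k =
      ∑ m ∈ Finset.range N, if ω.1 m = k then holdingTime Q ω m else 0 := by
  rw [occupationTime, hN]
  clear hN
  induction N with
  | zero => simp [jumpTime]
  | succ N ih =>
    have hle : (jumpTime Q ω N).toReal ≤ (jumpTime Q ω (N + 1)).toReal :=
      ENNReal.toReal_mono (jumpTime_ne_top hpos _) (jumpTime_mono N.le_succ)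
    have hmem : ∀ t ∈ Set.Ico (jumpTime Q ω N).toReal (jumpTime Q ω (N + 1)).toReal,
        0 ≤ t ∧ jumpTime Q ω N ≤ ENNReal.ofReal t ∧ ENNReal.ofReal t < jumpTime Q ω (N + 1) := by
      intro t ht
      have h0 : 0 ≤ t := ENNReal.toReal_nonneg.trans ht.1
      exact ⟨h0, ENNReal.le_ofReal_iff_toReal_le (jumpTime_ne_top hpos _) h0 |>.2 ht.1,
        ENNReal.ofReal_lt_iff_lt_toReal h0 (jumpTime_ne_top hpos _) |>.2 ht.2⟩
    have hU : {t : ℝ | 0 ≤ t ∧ ENNReal.ofReal t < jumpTime Q ω (N + 1)} =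
        {t : ℝ | 0 ≤ t ∧ ENNReal.ofReal t < jumpTime Q ω N} ∪
          Set.Ico (jumpTime Q ω N).toReal (jumpTime Q ω (N + 1)).toReal := by
      ext t
      constructor
      · rintro ⟨h0, h1⟩
        rcases lt_or_ge (ENNReal.ofReal t) (jumpTime Q ω N) with h | h
        · exact Or.inl ⟨h0, h⟩
        · exact Or.inr ⟨ENNReal.le_ofReal_iff_toReal_le (jumpTime_ne_top hpos _) h0 |>.1 h,
            ENNReal.ofReal_lt_iff_lt_toReal h0 (jumpTime_ne_top hpos _) |>.1 h1⟩
      · rintro (⟨h0, h1⟩ | h)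
        · exact ⟨h0, h1.trans_le (jumpTime_mono N.le_succ)⟩
        · exact ⟨(hmem t h).1, (hmem t h).2.2⟩
    have hD : Disjoint {t : ℝ | 0 ≤ t ∧ ENNReal.ofReal t < jumpTime Q ω N}
        (Set.Ico (jumpTime Q ω N).toReal (jumpTime Q ω (N + 1)).toReal) :=
      Set.disjoint_left.2 fun t ht ht' => (hmem t ht').2.1.not_gt ht.2
    rw [hU, lintegral_union measurableSet_Ico hD, ih, Finset.sum_range_succ]
    congr 1
    have hconst : Set.EqOn ({t : ℝ | chain Q ω t = k}.indicator (1 : ℝ → ℝ≥0∞))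
        (fun _ => if ω.1 N = k then 1 else 0)
        (Set.Ico (jumpTime Q ω N).toReal (jumpTime Q ω (N + 1)).toReal) := by
      intro t ht
      have := chain_eq (hmem t ht).2.1 (hmem t ht).2.2
      simp [Set.indicator_apply, this]
    rw [setLIntegral_congr_fun measurableSet_Ico hconst, setLIntegral_const, Real.volume_Ico,
      ENNReal.ofReal_sub _ ENNReal.toReal_nonneg, ENNReal.ofReal_toReal (jumpTime_ne_top hpos _),
      ENNReal.ofReal_toReal (jumpTime_ne_top hpos _), jumpTime_succ,
      ENNReal.add_sub_cancel_left (jumpTime_ne_top hpos _)]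
    split_ifs <;> simp

end Paths

/-! ### The maximum principle for irreducible rate matrices -/

section MaximumPrinciple

variable {V : Type*} [Fintype V] [DecidableEq V] {Q : Matrix V V ℝ} {T : Set V}

/-- Maximum principle: a function that vanishes on the nonempty set `T` and is subharmonic off `T`
is nonpositive. -/
theorem IsRateMatrix.le_zero_of_subharmonic (hQ : IsRateMatrix Q) (hirr : IsIrreducible Q)
    (hT : T.Nonempty) {y : V → ℝ} (hyT : ∀ i ∈ T, y i = 0)
    (hy : ∀ i ∉ T, 0 ≤ Q.mulVec y i) (i : V) : y i ≤ 0 := by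
  obtain ⟨t, ht⟩ := hT
  obtain ⟨i₀, -, hmax⟩ := Finset.exists_max_image Finset.univ y ⟨t, Finset.mem_univ t⟩
  by_contra! hi
  have hM : 0 < y i₀ := hi.trans_le (hmax i (Finset.mem_univ i))
  have key : ∀ b, Relation.ReflTransGen (fun a b => a ≠ b ∧ 0 < Q a b) i₀ b → y b = y i₀ := by
    intro b hb
    induction hb with
    | refl => rfl
    | @tail a b _ hab ih =>
      have haT : a ∉ T := fun h => by rw [hyT a h] at ih; exact hM.ne ih
      have h1 : 0 ≤ ∑ j, Q a j * (y j - y i₀) := by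
        simp_rw [mul_sub, Finset.sum_sub_distrib, ← Finset.sum_mul, hQ.row_sum]
        simpa [Matrix.mulVec, dotProduct] using hy a haT
      have h2 : ∀ j ∈ Finset.univ, Q a j * (y j - y i₀) ≤ 0 := by
        intro j _
        by_cases hj : a = j
        · rw [← hj, ih, sub_self, mul_zero]
        · exact mul_nonpos_of_nonneg_of_nonpos (hQ.offDiag_nonneg _ _ hj)
            (sub_nonpos.2 (hmax j (Finset.mem_univ j)))
      have h3 := (Finset.sum_eq_zero_iff_of_nonpos h2).1
        (le_antisymm (Finset.sum_nonpos h2) h1) b (Finset.mem_univ b)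
      rcases mul_eq_zero.1 h3 with h | h
      · exact absurd h hab.2.ne'
      · exact sub_eq_zero.1 h
  have := key t (hirr i₀ t)
  rw [hyT t ht] at this
  exact hM.ne this

/-- The Dirichlet problem `Q f = b` off `T`, `f = 0` on `T` has a solution. -/
theorem IsRateMatrix.exists_dirichlet (hQ : IsRateMatrix Q) (hirr : IsIrreducible Q)
    (hT : T.Nonempty) (b : V → ℝ) :
    ∃ f : V → ℝ, (∀ i ∈ T, f i = 0) ∧ ∀ i ∉ T, Q.mulVec f i = b i := by
  classical
  -- impose the boundary condition through the rows in `T`; the square system is then injective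
  let M : Matrix V V ℝ := fun i => if i ∈ T then Pi.single i 1 else Q i
  have hMT : ∀ f, ∀ i ∈ T, M.mulVec f i = f i := fun f i hi => by
    simp [M, Matrix.mulVec, hi]
  have hM : ∀ f, ∀ i ∉ T, M.mulVec f i = Q.mulVec f i := fun f i hi => by
    simp [M, Matrix.mulVec, hi]
  have hinj : Function.Injective M.mulVecLin := by
    rw [← LinearMap.ker_eq_bot, LinearMap.ker_eq_bot']
    intro y hy
    rw [Matrix.mulVecLin_apply] at hy
    have h1 : ∀ i ∈ T, y i = 0 := fun i hi => by rw [← hMT y i hi, hy]; rfl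
    have h2 : ∀ i ∉ T, Q.mulVec y i = 0 := fun i hi => by rw [← hM y i hi, hy]; rfl
    ext i
    refine le_antisymm (hQ.le_zero_of_subharmonic hirr hT h1 (fun i hi => (h2 i hi).ge) i) ?_
    have := hQ.le_zero_of_subharmonic hirr hT (y := -y) (fun i hi => by simp [h1 i hi])
      (fun i hi => by simp [Matrix.mulVec_neg, h2 i hi]) i
    simpa using this
  obtain ⟨f, hf⟩ := LinearMap.injective_iff_surjective.1 hinj fun i => if i ∈ T then 0 else b i
  rw [Matrix.mulVecLin_apply] at hf
  refine ⟨f, fun i hi => ?_, fun i hi => ?_⟩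
  · rw [← hMT f i hi, hf]
    exact if_pos hi
  · rw [← hM f i hi, hf]
    exact if_neg hi

/-- A vector that vanishes on `T` and is annihilated by `Q` off `T` is zero. -/
theorem IsRateMatrix.eq_zero_of_vecMul (hQ : IsRateMatrix Q) (hirr : IsIrreducible Q)
    (hT : T.Nonempty) {ρ : V → ℝ} (h0 : ∀ i ∈ T, ρ i = 0)
    (h : ∀ k ∉ T, Matrix.vecMul ρ Q k = 0) : ρ = 0 := by
  obtain ⟨f, hfT, hf⟩ := hQ.exists_dirichlet hirr hT ρ
  -- `f` solves `Q f = ρ` off `T`, hence `ρ ⬝ ρ = ρ ⬝ Q f = ρ Q ⬝ f = 0`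
  have h1 : dotProduct ρ (Q.mulVec f) = 0 := by
    rw [Matrix.dotProduct_mulVec]
    refine Finset.sum_eq_zero fun k _ => ?_
    by_cases hk : k ∈ T
    · rw [hfT k hk, mul_zero]
    · rw [h k hk, zero_mul]
  have h2 : dotProduct ρ (Q.mulVec f) = dotProduct ρ ρ := by
    refine Finset.sum_congr rfl fun k _ => ?_
    by_cases hk : k ∈ T
    · rw [h0 k hk, zero_mul, zero_mul]
    · rw [hf k hk]
  exact dotProduct_self_eq_zero.1 (h2.symm.trans h1)

theorem IsRateMatrix.exitRate_pos [Nontrivial V] (hQ : IsRateMatrix Q) (hirr : IsIrreducible Q)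
    (i : V) : 0 < exitRate Q i := by
  obtain ⟨j, hj⟩ := exists_ne i
  rcases Relation.ReflTransGen.cases_head (hirr i j) with h | ⟨c, hc, -⟩
  · exact absurd h.symm hj
  · refine Finset.sum_pos' (fun j hj => hQ.offDiag_nonneg _ _ (Finset.ne_of_mem_erase hj).symm)
      ⟨c, Finset.mem_erase.2 ⟨hc.1.symm, Finset.mem_univ c⟩, hc.2⟩

/-- The support of a nonnegative null vector of an irreducible rate matrix is all or nothing. -/
theorem IsRateMatrix.eq_zero_of_apply_eq_zero (hQ : IsRateMatrix Q) (hirr : IsIrreducible Q)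
    {ρ : V → ℝ} (hρ : ∀ i, 0 ≤ ρ i) (h : Matrix.vecMul ρ Q = 0) {k : V} (hk : ρ k = 0) (i : V) :
    ρ i = 0 := by
  refine Relation.ReflTransGen.head_induction_on (hirr i k) hk ?_
  intro a b hab _ hb
  have h1 : ∑ j, ρ j * Q j b = 0 := congrFun h b
  have h2 : ∀ j ∈ Finset.univ, 0 ≤ ρ j * Q j b := by
    intro j _
    by_cases hj : j = b
    · rw [hj, hb, zero_mul]
    · exact mul_nonneg (hρ j) (hQ.offDiag_nonneg _ _ hj)
  rcases mul_eq_zero.1 ((Finset.sum_eq_zero_iff_of_nonneg h2).1 h1 a (Finset.mem_univ a))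
    with h3 | h3
  · exact h3
  · exact absurd h3 hab.2.ne'

end MaximumPrinciple

/-! ### The Green function of the killed jump chain -/

section Green

variable {V : Type*} [Fintype V] [DecidableEq V] [MeasurableSpace V] [MeasurableSingletonClass V]
  {Q : Matrix V V ℝ} {T : Set V}

/-- The expected number of visits of the jump chain from `i` to `k` (the start included) before
it enters `T` at a positive step. -/
noncomputable def green (Q : Matrix V V ℝ) (T : Set V) (i k : V) : ℝ≥0∞ :=
  ∑' n, killedProb Q T i n k

theorem green_of_mem (Q : Matrix V V ℝ) (i : V) {k : V} (hk : k ∈ T) :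
    green Q T i k = if k = i then 1 else 0 := by
  rw [green, tsum_eq_zero_add' ENNReal.summable, killedProb_zero]
  simp [killedProb_of_mem Q i _ hk]

/-- Decomposition of the visits to `k` according to the state visited just before. -/
theorem green_of_notMem (Q : Matrix V V ℝ) {i k : V} (hk : k ∉ T) :
    green Q T i k = (if k = i then 1 else 0) + ∑ j, green Q T i j * jumpLaw Q j k := by
  rw [green, tsum_eq_zero_add' ENNReal.summable, killedProb_zero]
  simp_rw [killedProb_succ Q i _ hk, green, ← ENNReal.tsum_mul_right]
  rw [Summable.tsum_finsetSum fun _ _ => ENNReal.summable]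

theorem killedProb_le_one (Q : Matrix V V ℝ) (T : Set V) (i : V) (n : ℕ) (k : V) :
    killedProb Q T i n k ≤ 1 := prob_le_one

/-- The jump chain from anywhere makes a finite expected number of steps before it enters `T`. The
expected number `f` of steps satisfies `P f + 1 = f` off `T`, so that the `f`-mass of the killed
chain drops at each step by its total mass. -/
theorem IsRateMatrix.tsum_sum_killedProb_ne_top (hQ : IsRateMatrix Q) (hirr : IsIrreducible Q)
    (hpos : ∀ i, 0 < exitRate Q i) (hT : T.Nonempty) (i : V) :
    ∑' n, ∑ k, killedProb Q T i n k ≠ ∞ := by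
  obtain ⟨f, hfT, hf⟩ := hQ.exists_dirichlet hirr hT fun i => -exitRate Q i
  have hf0 : ∀ j, 0 ≤ f j := by
    intro j
    have := hQ.le_zero_of_subharmonic hirr hT (y := -f) (fun i hi => by simp [hfT i hi])
      (fun i hi => by simp [Matrix.mulVec_neg, hf i hi, (hpos i).le]) j
    simpa using this
  have hreal : ∀ j ∉ T, ∑ k, (jumpLaw Q j k).toReal * f k + 1 = f j := by
    intro j hj
    have h1 : ∑ k, Q j k * f k = -exitRate Q j := hf j hj
    have h2 : ∑ k, Q j k * f k = exitRate Q j * (∑ k, (jumpLaw Q j k).toReal * f k - f j) := by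
      rw [mul_sub, Finset.mul_sum, ← Finset.add_sum_erase _ _ (Finset.mem_univ j),
        ← Finset.add_sum_erase _ (fun k => exitRate Q j * _) (Finset.mem_univ j),
        hQ.jumpLaw_self (hpos j), hQ.exitRate_eq j]
      have : ∀ k ∈ Finset.univ.erase j, Q j k * f k =
          -Q j j * ((jumpLaw Q j k).toReal * f k) := by
        intro k hk
        rw [← mul_assoc, ← hQ.exitRate_eq j,
          hQ.exitRate_mul_jumpLaw (hpos j) (Finset.ne_of_mem_erase hk).symm]
      rw [Finset.sum_congr rfl this]
      simp
      ring
    rw [h2] at h1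
    have h3 : exitRate Q j * (∑ k, (jumpLaw Q j k).toReal * f k + 1 - f j) = 0 := by linarith
    have := (mul_eq_zero.1 h3).resolve_left (hpos j).ne'
    linarith
  have hF : ∀ j ∉ T, ∑ k, jumpLaw Q j k * ENNReal.ofReal (f k) + 1 = ENNReal.ofReal (f j) := by
    intro j hj
    rw [← hreal j hj, ENNReal.ofReal_add (Finset.sum_nonneg fun k _ =>
      mul_nonneg ENNReal.toReal_nonneg (hf0 k)) zero_le_one, ENNReal.ofReal_one,
      ENNReal.ofReal_sum_of_nonneg fun k _ => mul_nonneg ENNReal.toReal_nonneg (hf0 k)]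
    congr 1
    refine Finset.sum_congr rfl fun k _ => ?_
    rw [ENNReal.ofReal_mul ENNReal.toReal_nonneg, ENNReal.ofReal_toReal (PMF.apply_ne_top _ _)]
  -- step `0` is left out, because the start may lie in `T`, where `hF` fails
  set a : ℕ → ℝ≥0∞ := fun n => ∑ k, killedProb Q T i (n + 1) k * ENNReal.ofReal (f k)
  have ha : ∀ n, ∑ k, killedProb Q T i (n + 1) k + a (n + 1) = a n := by
    intro n
    have h1 : a (n + 1) = ∑ k, ∑ j, killedProb Q T i (n + 1) j *
        (jumpLaw Q j k * ENNReal.ofReal (f k)) := by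
      refine Finset.sum_congr rfl fun k _ => ?_
      by_cases hk : k ∈ T
      · simp [hfT k hk]
      · rw [killedProb_succ Q i _ hk, Finset.sum_mul]
        exact Finset.sum_congr rfl fun j _ => mul_assoc _ _ _
    rw [h1, Finset.sum_comm, ← Finset.sum_add_distrib]
    refine Finset.sum_congr rfl fun j _ => ?_
    by_cases hj : j ∈ T
    · simp [killedProb_of_mem Q i _ hj]
    · rw [← hF j hj, ← Finset.mul_sum, mul_add, mul_one, add_comm]
  have hsum : ∀ N, ∑ n ∈ Finset.range N, ∑ k, killedProb Q T i (n + 1) k + a N = a 0 := by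
    intro N
    induction N with
    | zero => simp
    | succ N ih => rw [Finset.sum_range_succ, add_assoc, ha, ih]
  have htop : ∀ n, ∑ k, killedProb Q T i n k ≠ ∞ := fun n =>
    ENNReal.sum_ne_top.2 fun k _ => ne_top_of_le_ne_top ENNReal.one_ne_top
      (killedProb_le_one Q T i n k)
  rw [tsum_eq_zero_add' ENNReal.summable]
  refine ENNReal.add_ne_top.2 ⟨htop 0, ne_top_of_le_ne_top (b := a 0) ?_ ?_⟩
  · exact ENNReal.sum_ne_top.2 fun k _ => ENNReal.mul_ne_top
      (ne_top_of_le_ne_top ENNReal.one_ne_top (killedProb_le_one Q T i _ k)) ENNReal.ofReal_ne_top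
  · exact ENNReal.tsum_le_of_sum_range_le fun N => le_self_add.trans (hsum N).le

theorem IsRateMatrix.green_ne_top (hQ : IsRateMatrix Q) (hirr : IsIrreducible Q)
    (hpos : ∀ i, 0 < exitRate Q i) (hT : T.Nonempty) (i k : V) : green Q T i k ≠ ∞ :=
  ne_top_of_le_ne_top (hQ.tsum_sum_killedProb_ne_top hirr hpos hT i) <|
    ENNReal.tsum_le_tsum fun n =>
      Finset.single_le_sum (f := killedProb Q T i n) (fun _ _ => zero_le) (Finset.mem_univ k)

/-- The jump chain enters `T` almost surely. -/
theorem IsRateMatrix.ae_exists_mem (hQ : IsRateMatrix Q) (hirr : IsIrreducible Q)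
    (hpos : ∀ i, 0 < exitRate Q i) (hT : T.Nonempty) (i : V) :
    ∀ᵐ x ∂jumpChainLaw Q i, ∃ n, x ∈ avoids T n ∧ x (n + 1) ∈ T := by
  classical
  have h1 : jumpChainLaw Q i {x | ∀ n, x ∈ avoids T n} = 0 := by
    refine le_antisymm (le_of_tendsto_of_tendsto' tendsto_const_nhds
      (ENNReal.tendsto_atTop_zero_of_tsum_ne_top
        (hQ.tsum_sum_killedProb_ne_top hirr hpos hT i)) fun n => ?_) zero_le
    refine (measure_mono (t := ⋃ k ∈ (Finset.univ : Finset V),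
      {x | x ∈ avoids T n ∧ x n = k}) fun x hx => ?_).trans (measure_biUnion_finset_le _ _)
    simpa using hx n
  have h2 : ∀ᵐ x ∂jumpChainLaw Q i, ¬ ∀ n, x ∈ avoids T n := by
    rw [ae_iff]; simpa using h1
  filter_upwards [h2] with x hx
  rw [not_forall] at hx
  obtain ⟨n, hn⟩ : ∃ n, Nat.find hx = n + 1 := by
    refine Nat.exists_eq_succ_of_ne_zero fun h => ?_
    have := Nat.find_spec hx
    rw [h] at this
    exact this fun m h1 h2 => absurd h1 (by omega)
  have h3 : x ∈ avoids T n := not_not.1 (Nat.find_min hx (m := n) (by omega))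
  have h4 : x ∉ avoids T (n + 1) := hn ▸ Nat.find_spec hx
  refine ⟨n, h3, by_contra fun h => h4 fun m hm1 hm2 => ?_⟩
  rcases Nat.lt_or_ge n m with h5 | h5
  · obtain rfl : m = n + 1 := by omega
    exact h
  · exact h3 m hm1 h5

end Green

/-! ### Where the jump chain enters a set -/

section Endpoints

variable {V : Type*} {T : Set V}

/-- The event that the sequence of states first enters `T`, at a positive step, in the state `e`. -/
def entersAt (T : Set V) (e : V) : Set (ℕ → V) := {x | ∃ n, x ∈ avoids T n ∧ x (n + 1) = e}

theorem avoids_anti {m n : ℕ} (h : m ≤ n) : avoids T n ⊆ avoids T m :=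
  fun _ hx i h1 h2 => hx i h1 (h2.trans h)

theorem eq_of_avoids {x : ℕ → V} {m n : ℕ} (hm : x ∈ avoids T m) (hmT : x (m + 1) ∈ T)
    (hn : x ∈ avoids T n) (hnT : x (n + 1) ∈ T) : m = n := by
  rcases lt_trichotomy m n with h | h | h
  · exact absurd hmT (hn (m + 1) m.succ_pos h)
  · exact h
  · exact absurd hnT (hm (n + 1) n.succ_pos h)

theorem mem_avoids_iff_le {x : ℕ → V} {m n : ℕ} (hn : x ∈ avoids T n) (hnT : x (n + 1) ∈ T) :
    x ∈ avoids T m ↔ m ≤ n := by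
  refine ⟨fun h => not_lt.1 fun hlt => ?_, fun h => avoids_anti h hn⟩
  exact h (n + 1) n.succ_pos hlt hnT

theorem disjoint_entersAt {e e' : V} (he : e ∈ T) (he' : e' ∈ T) (hne : e ≠ e') :
    Disjoint (entersAt T e) (entersAt T e') := by
  refine Set.disjoint_left.2 ?_
  rintro x ⟨m, hm, hme⟩ ⟨n, hn, hne'⟩
  obtain rfl := eq_of_avoids hm (hme ▸ he) hn (hne' ▸ he')
  exact hne (hme.symm.trans hne')

variable [Fintype V] [DecidableEq V] [MeasurableSpace V] [MeasurableSingletonClass V]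
  {Q : Matrix V V ℝ}

theorem measurableSet_entersAt {V : Type*} [Finite V] [MeasurableSpace V]
    [MeasurableSingletonClass V] (T : Set V) (e : V) : MeasurableSet (entersAt T e) := by
  have : entersAt T e = ⋃ n, {x | x ∈ avoids T n ∧ x (n + 1) = e} := by
    ext x; simp [entersAt]
  rw [this]
  exact MeasurableSet.iUnion fun n => (measurableSet_avoids T n).inter (measurableSet_coord _ e)

/-- The sum over `n` of `jumpChainLaw_avoids_succ`: the probability that `e` is the entrance state is
the expected number of visits weighted by the probability to jump to `e`. -/
theorem jumpChainLaw_entersAt (Q : Matrix V V ℝ) (i : V) {e : V} (he : e ∈ T) :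
    jumpChainLaw Q i (entersAt T e) = ∑ j, green Q T i j * jumpLaw Q j e := by
  have h : entersAt T e = ⋃ n, {x | x ∈ avoids T n ∧ x (n + 1) = e} := by
    ext x; simp [entersAt]
  rw [h, measure_iUnion]
  · simp_rw [jumpChainLaw_avoids_succ, green, ← ENNReal.tsum_mul_right]
    rw [Summable.tsum_finsetSum fun _ _ => ENNReal.summable]
  · intro m n hmn
    refine Set.disjoint_left.2 fun x hm hn => hmn ?_
    exact eq_of_avoids hm.1 (hm.2 ▸ he) hn.1 (hn.2 ▸ he)
  · exact fun n => (measurableSet_avoids T n).inter (measurableSet_coord _ e)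

end Endpoints

/-! ### Excursions from the distinguished states -/

section Excursion

variable {V : Type*} [Fintype V] [DecidableEq V]
  {Q : Matrix V V ℝ} {g : Fin 2 → V} {ω : (ℕ → V) × (ℕ → ℝ)}

theorem hitTime_of_avoids (hpos : ∀ i, 0 < exitRate Q i) (hω : ∀ n, 0 < ω.2 n)
    (hne : ω.1 1 ≠ ω.1 0) {e : Fin 2} {n : ℕ} (hn : ω.1 ∈ avoids (Set.range g) n)
    (he : ω.1 (n + 1) = g e) : hitTime (chain Q ω) (g e) = jumpTime Q ω (n + 1) := by
  refine hitTime_eq_jumpTime hpos hω hne n.succ_pos he fun m h1 h2 h3 => ?_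
  exact hn m h1 (by omega) ⟨e, h3.symm⟩

theorem mem_endsIn_of_avoids (hg : Function.Injective g) (hpos : ∀ i, 0 < exitRate Q i)
    (hω : ∀ n, 0 < ω.2 n) (hne : ω.1 1 ≠ ω.1 0) {e : Fin 2} {n : ℕ}
    (hn : ω.1 ∈ avoids (Set.range g) n) (he : ω.1 (n + 1) = g e) : ω ∈ endsIn Q g e := by
  change hitTime _ _ < hitTime _ _
  rw [hitTime_of_avoids hpos hω hne hn he]
  refine (jumpTime_strictMono hpos hω (n + 1).lt_succ_self).trans_le
    (jumpTime_le_hitTime hpos hω fun m h1 h2 h3 => ?_)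
  rcases Nat.lt_or_ge n m with h4 | h4
  · obtain rfl : m = n + 1 := by omega
    have := hg (he.symm.trans h3)
    revert this
    fin_cases e <;> decide
  · exact hn m h1 h4 ⟨_, h3.symm⟩

theorem mem_endsIn_iff (hg : Function.Injective g) (hpos : ∀ i, 0 < exitRate Q i)
    (hω : ∀ n, 0 < ω.2 n) (hne : ω.1 1 ≠ ω.1 0)
    (hT : ∃ n, ω.1 ∈ avoids (Set.range g) n ∧ ω.1 (n + 1) ∈ Set.range g) (e : Fin 2) :
    ω ∈ endsIn Q g e ↔ ω.1 ∈ entersAt (Set.range g) (g e) := by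
  refine ⟨fun h => ?_, fun ⟨n, hn, he⟩ => mem_endsIn_of_avoids hg hpos hω hne hn he⟩
  obtain ⟨n, hn, e', he'⟩ := hT
  have h' := mem_endsIn_of_avoids hg hpos hω hne hn he'.symm
  obtain rfl | rfl : e = e' ∨ e = 1 - e' := by
    fin_cases e <;> fin_cases e' <;> simp
  · exact ⟨n, hn, he'.symm⟩
  · change hitTime _ _ < hitTime _ _ at h h'
    rw [sub_sub_cancel] at h
    exact absurd h h'.not_gt

theorem IsRateMatrix.exitRate_pos_of_injective (hQ : IsRateMatrix Q)
    (hirr : IsIrreducible Q) (hg : Function.Injective g) (i : V) : 0 < exitRate Q i := by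
  have : Nontrivial V := ⟨g 0, g 1, fun h => by simpa using hg h⟩
  exact hQ.exitRate_pos hirr i

/-- The time that the path spends in `k` while the jump chain has not yet entered `T` at a positive
step, as a sum over the visits to `k`. -/
noncomputable def visitTime (Q : Matrix V V ℝ) (T : Set V) (k : V)
    (ω : (ℕ → V) × (ℕ → ℝ)) : ℝ≥0∞ :=
  ∑' n, {x | x ∈ avoids T n ∧ x n = k}.indicator 1 ω.1 *
    (ENNReal.ofReal (ω.2 n) / ENNReal.ofReal (exitRate Q k))

theorem occupationTime_eq_visitTime (hpos : ∀ i, 0 < exitRate Q i) (hω : ∀ n, 0 < ω.2 n)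
    (hne : ω.1 1 ≠ ω.1 0) {e : Fin 2} (he : ω.1 ∈ entersAt (Set.range g) (g e)) (k : V) :
    occupationTime (chain Q ω) (g e) k = visitTime Q (Set.range g) k ω := by
  obtain ⟨n, hn, he⟩ := he
  rw [occupationTime_eq_sum hpos (hitTime_of_avoids hpos hω hne hn he), visitTime,
    tsum_eq_sum (s := Finset.range (n + 1))]
  · refine Finset.sum_congr rfl fun m hm => ?_
    have hm' : ω.1 ∈ avoids (Set.range g) m :=
      avoids_anti (Nat.lt_succ_iff.1 (Finset.mem_range.1 hm)) hn
    split_ifs with h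
    · simp [hm', h, holdingTime]
    · simp [h]
  · intro m hm
    have : ω.1 ∉ avoids (Set.range g) m := by
      rw [mem_avoids_iff_le hn (he ▸ ⟨e, rfl⟩)]
      simpa [Nat.lt_succ_iff] using hm
    simp [this]

variable [MeasurableSpace V] [MeasurableSingletonClass V]

theorem chainLaw_ae_fst (i : V) {p : (ℕ → V) → Prop} (hp : ∀ᵐ x ∂jumpChainLaw Q i, p x) :
    ∀ᵐ ω ∂chainLaw Q i, p ω.1 :=
  Measure.quasiMeasurePreserving_fst.ae hp

theorem chainLaw_ae_snd_pos (i : V) : ∀ᵐ ω ∂chainLaw Q i, ∀ n, 0 < ω.2 n := by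
  have h : ∀ᵐ y ∂(Measure.infinitePi fun _ : ℕ => expMeasure 1), ∀ n, 0 < y n :=
    ae_all_iff.2 fun n => (measurePreserving_eval_infinitePi
      (fun _ : ℕ => expMeasure 1) n).quasiMeasurePreserving.ae expMeasure_ae_pos
  exact Measure.quasiMeasurePreserving_snd.ae h

/-- The jump chain and the clocks are independent, and a clock has mean one. -/
theorem lintegral_visitTime (i k : V) (T : Set V) :
    ∫⁻ ω, visitTime Q T k ω ∂chainLaw Q i = green Q T i k / ENNReal.ofReal (exitRate Q k) := by
  have hm : ∀ n, Measurable ({x : ℕ → V | x ∈ avoids T n ∧ x n = k}.indicator (1 : (ℕ → V) → ℝ≥0∞)) :=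
    fun n => measurable_one.indicator (measurableSet_killed T n k)
  have hm2 : ∀ n, Measurable fun y : ℕ → ℝ =>
      ENNReal.ofReal (y n) / ENNReal.ofReal (exitRate Q k) := fun n => by fun_prop
  have hm3 : ∀ n, AEMeasurable (fun ω : (ℕ → V) × (ℕ → ℝ) =>
      {x | x ∈ avoids T n ∧ x n = k}.indicator (1 : (ℕ → V) → ℝ≥0∞) ω.1 *
        (ENNReal.ofReal (ω.2 n) / ENNReal.ofReal (exitRate Q k))) (chainLaw Q i) := fun n =>
    (((hm n).comp measurable_fst).mul ((hm2 n).comp measurable_snd)).aemeasurable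
  simp only [visitTime]
  rw [lintegral_tsum hm3, green, div_eq_mul_inv, ← ENNReal.tsum_mul_right]
  refine tsum_congr fun n => ?_
  rw [chainLaw, lintegral_prod_mul (hm n).aemeasurable (hm2 n).aemeasurable,
    lintegral_indicator_one (measurableSet_killed T n k), killedProb]
  congr 1
  simp_rw [div_eq_mul_inv]
  rw [lintegral_mul_const _ (by fun_prop), (measurePreserving_eval_infinitePi
    (fun _ : ℕ => expMeasure 1) n).lintegral_comp (f := fun x => ENNReal.ofReal x) (by fun_prop),
    lintegral_ofReal_expMeasure, one_mul]

/-- The expected time that an excursion from `g ε` spends in `k`, restricted to the event that it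
ends in `g ε'`. -/
noncomputable def excursionTime (Q : Matrix V V ℝ) (g : Fin 2 → V) (ε ε' : Fin 2) (k : V) :
    ℝ≥0∞ :=
  ∫⁻ ω, (endsIn Q g ε').indicator (fun ω => occupationTime (chain Q ω) (g ε') k) ω
    ∂chainLaw Q (g ε)

theorem excursionRate_nonneg (hQ : IsRateMatrix Q) (ε ε' : Fin 2) : 0 ≤ excursionRate Q g ε ε' :=
  mul_nonneg (hQ.exitRate_nonneg _) ENNReal.toReal_nonneg

/-- The probability of the condition cancels. -/
theorem excursionRate_mul_condOccupation (Q : Matrix V V ℝ) (g : Fin 2 → V) (ε ε' : Fin 2) (k : V) :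
    excursionRate Q g ε ε' * (condOccupation Q g ε ε' k).toReal =
      exitRate Q (g ε) * (excursionTime Q g ε ε' k).toReal := by
  rw [excursionRate, mul_assoc, condOccupation]
  congr 1
  have htop : excursionProb Q g ε ε' ≠ ∞ := by
    have : IsProbabilityMeasure (chainLaw Q (g ε)) := by unfold chainLaw; infer_instance
    exact measure_ne_top _ _
  split_ifs with h
  · rw [ENNReal.toReal_div, mul_div_cancel₀]
    · rfl
    · exact (ENNReal.toReal_pos h htop).ne'
  · rw [not_not] at h
    have : excursionTime Q g ε ε' k = 0 := by
      rw [excursionTime]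
      refine (lintegral_congr_ae (g := 0) ?_).trans (by simp)
      have h' : ∀ᵐ ω ∂chainLaw Q (g ε), ω ∉ endsIn Q g ε' := by
        rw [ae_iff]; simpa [excursionProb] using h
      filter_upwards [h'] with ω hω
      exact Set.indicator_of_notMem hω _
    simp [this]

section

variable (hQ : IsRateMatrix Q) (hirr : IsIrreducible Q) (hg : Function.Injective g)
include hQ hirr hg

theorem ae_excursion (i : V) : ∀ᵐ ω ∂chainLaw Q i, (∀ n, 0 < ω.2 n) ∧ ω.1 1 ≠ ω.1 0 ∧
    ∃ n, ω.1 ∈ avoids (Set.range g) n ∧ ω.1 (n + 1) ∈ Set.range g := by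
  have hpos := hQ.exitRate_pos_of_injective hirr hg
  filter_upwards [chainLaw_ae_snd_pos i, chainLaw_ae_fst i (jumpChainLaw_ae_ne hQ hpos i),
    chainLaw_ae_fst i (hQ.ae_exists_mem hirr hpos (Set.range_nonempty g) i)] with ω h1 h2 h3
  exact ⟨h1, h2, h3⟩

theorem excursionProb_eq (ε ε' : Fin 2) : excursionProb Q g ε ε' =
    ∑ j, green Q (Set.range g) (g ε) j * jumpLaw Q j (g ε') := by
  rw [← jumpChainLaw_entersAt Q (g ε) (Set.mem_range_self ε'), excursionProb]
  have h : endsIn Q g ε' =ᵐ[chainLaw Q (g ε)]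
      (entersAt (Set.range g) (g ε') ×ˢ Set.univ : Set ((ℕ → V) × (ℕ → ℝ))) := by
    filter_upwards [ae_excursion hQ hirr hg (g ε)] with ω ⟨h1, h2, h3⟩
    apply propext
    change ω ∈ endsIn Q g ε' ↔ ω ∈ entersAt (Set.range g) (g ε') ×ˢ Set.univ
    simpa using mem_endsIn_iff hg (hQ.exitRate_pos_of_injective hirr hg) h1 h2 h3 ε'
  rw [measure_congr h, chainLaw, Measure.prod_prod, measure_univ, mul_one]

theorem excursionTime_eq (ε ε' : Fin 2) (k : V) : excursionTime Q g ε ε' k =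
    ∫⁻ ω in Prod.fst ⁻¹' entersAt (Set.range g) (g ε'), visitTime Q (Set.range g) k ω
      ∂chainLaw Q (g ε) := by
  rw [excursionTime, ← lintegral_indicator (measurable_fst (measurableSet_entersAt _ _))]
  refine lintegral_congr_ae ?_
  filter_upwards [ae_excursion hQ hirr hg (g ε)] with ω ⟨h1, h2, h3⟩
  have hpos := hQ.exitRate_pos_of_injective hirr hg
  have h := mem_endsIn_iff hg hpos h1 h2 h3 ε'
  by_cases hω : ω.1 ∈ entersAt (Set.range g) (g ε')
  · rw [Set.indicator_of_mem (h.2 hω), Set.indicator_of_mem (by exact hω),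
      occupationTime_eq_visitTime hpos h1 h2 hω]
  · rw [Set.indicator_of_notMem (fun h' => hω (h.1 h')), Set.indicator_of_notMem (by exact hω)]

/-- Every excursion ends in one of the two distinguished states. -/
theorem excursionTime_add (ε : Fin 2) (k : V) :
    excursionTime Q g ε ε k + excursionTime Q g ε (1 - ε) k =
      green Q (Set.range g) (g ε) k / ENNReal.ofReal (exitRate Q k) := by
  have hsym : excursionTime Q g ε ε k + excursionTime Q g ε (1 - ε) k =
      excursionTime Q g ε 0 k + excursionTime Q g ε 1 k := by
    obtain rfl | rfl : ε = 0 ∨ ε = 1 := by fin_cases ε <;> simp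
    · rfl
    · exact add_comm _ _
  have hd : Disjoint (entersAt (Set.range g) (g 0)) (entersAt (Set.range g) (g 1)) :=
    disjoint_entersAt ⟨0, rfl⟩ ⟨1, rfl⟩ fun h => by simpa using hg h
  rw [hsym, excursionTime_eq hQ hirr hg, excursionTime_eq hQ hirr hg,
    ← lintegral_union (measurable_fst (measurableSet_entersAt _ _)) (hd.preimage _),
    ← lintegral_visitTime]
  have h : (Prod.fst ⁻¹' entersAt (Set.range g) (g 0) ∪
      Prod.fst ⁻¹' entersAt (Set.range g) (g 1) : Set ((ℕ → V) × (ℕ → ℝ)))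
        =ᵐ[chainLaw Q (g ε)] Set.univ := by
    rw [Filter.eventuallyEq_univ]
    filter_upwards [ae_excursion hQ hirr hg (g ε)] with ω ⟨h1, h2, n, hn, e, he⟩
    obtain rfl | rfl : e = 0 ∨ e = 1 := by fin_cases e <;> simp
    · exact Or.inl ⟨n, hn, he.symm⟩
    · exact Or.inr ⟨n, hn, he.symm⟩
  rw [setLIntegral_congr h, setLIntegral_univ]

theorem excursionTime_ne_top (ε ε' : Fin 2) (k : V) : excursionTime Q g ε ε' k ≠ ∞ := by
  have hpos := hQ.exitRate_pos_of_injective hirr hg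
  rw [excursionTime_eq hQ hirr hg]
  refine ne_top_of_le_ne_top ?_ (setLIntegral_le_lintegral _ _)
  rw [lintegral_visitTime]
  exact ENNReal.div_ne_top (hQ.green_ne_top hirr hpos (Set.range_nonempty g) _ _)
    (by simpa using hpos k)

theorem condOccupation_ne_top (ε ε' : Fin 2) (k : V) : condOccupation Q g ε ε' k ≠ ∞ := by
  rw [condOccupation]
  split_ifs with h
  · exact ENNReal.div_ne_top (excursionTime_ne_top hQ hirr hg ε ε' k) h
  · exact ENNReal.zero_ne_top

theorem excursionWeight_eq (ε : Fin 2) (k : V) : excursionWeight Q g ε k =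
    exitRate Q (g ε) * (green Q (Set.range g) (g ε) k).toReal / exitRate Q k := by
  rw [excursionWeight, excursionRate_mul_condOccupation, excursionRate_mul_condOccupation, ← mul_add,
    ← ENNReal.toReal_add (excursionTime_ne_top hQ hirr hg _ _ _)
      (excursionTime_ne_top hQ hirr hg _ _ _), excursionTime_add hQ hirr hg, ENNReal.toReal_div,
    ENNReal.toReal_ofReal (hQ.exitRate_nonneg k), mul_div_assoc]

theorem excursionWeight_nonneg (ε : Fin 2) (k : V) : 0 ≤ excursionWeight Q g ε k := by
  rw [excursionWeight_eq hQ hirr hg]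
  exact div_nonneg (mul_nonneg (hQ.exitRate_nonneg _) ENNReal.toReal_nonneg) (hQ.exitRate_nonneg k)

/-- At the distinguished states, where the excursion starts or ends, `excursionWeight` is still
meaningful: the initial stay counts as one visit. -/
theorem excursionWeight_apply (ε ε' : Fin 2) :
    excursionWeight Q g ε (g ε') = if ε' = ε then 1 else 0 := by
  have := (hQ.exitRate_pos_of_injective hirr hg (g ε)).ne'
  rw [excursionWeight_eq hQ hirr hg, green_of_mem Q _ (Set.mem_range_self ε')]
  by_cases h : ε' = ε
  · simp [h, this]
  · simp [h, hg.ne h]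

/-- Flow into `k`, expressed by the Green function of the jump chain. -/
theorem vecMul_excursionWeight (ε : Fin 2) (k : V) :
    Matrix.vecMul (excursionWeight Q g ε) Q k = exitRate Q (g ε) *
      ((∑ j, green Q (Set.range g) (g ε) j * jumpLaw Q j k).toReal -
        (green Q (Set.range g) (g ε) k).toReal) := by
  have hpos := hQ.exitRate_pos_of_injective hirr hg
  have hG := hQ.green_ne_top hirr hpos (Set.range_nonempty g) (g ε)
  rw [ENNReal.toReal_sum fun j _ => ENNReal.mul_ne_top (hG j) (PMF.apply_ne_top _ _)]
  simp_rw [ENNReal.toReal_mul]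
  rw [Matrix.vecMul, dotProduct, ← Finset.add_sum_erase _ _ (Finset.mem_univ k),
    ← Finset.add_sum_erase _ (fun j => _ * (jumpLaw Q j k).toReal) (Finset.mem_univ k),
    hQ.jumpLaw_self (hpos k), excursionWeight_eq hQ hirr hg]
  have h1 : ∀ j ∈ Finset.univ.erase k, excursionWeight Q g ε j * Q j k = exitRate Q (g ε) *
      ((green Q (Set.range g) (g ε) j).toReal * (jumpLaw Q j k).toReal) := by
    intro j hj
    rw [excursionWeight_eq hQ hirr hg, ← hQ.exitRate_mul_jumpLaw (hpos j)
      (Finset.ne_of_mem_erase hj)]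
    have := (hpos j).ne'
    field_simp
  rw [Finset.sum_congr rfl h1, ← Finset.mul_sum]
  have h2 : Q k k = -exitRate Q k := by rw [hQ.exitRate_eq, neg_neg]
  have := (hpos k).ne'
  rw [h2, ENNReal.toReal_zero, mul_zero, zero_add]
  field_simp
  ring

theorem vecMul_excursionWeight_of_notMem (ε : Fin 2) {k : V} (hk : k ∉ Set.range g) :
    Matrix.vecMul (excursionWeight Q g ε) Q k = 0 := by
  rw [vecMul_excursionWeight hQ hirr hg, green_of_notMem Q hk,
    if_neg fun h => hk ⟨ε, h.symm⟩, zero_add, sub_self, mul_zero]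

theorem vecMul_excursionWeight_apply (ε ε' : Fin 2) :
    Matrix.vecMul (excursionWeight Q g ε) Q (g ε') =
      if ε' = ε then -excursionRate Q g ε (1 - ε) else excursionRate Q g ε (1 - ε) := by
  have hother : Matrix.vecMul (excursionWeight Q g ε) Q (g (1 - ε)) =
      excursionRate Q g ε (1 - ε) := by
    have hne : 1 - ε ≠ ε := by fin_cases ε <;> decide
    rw [vecMul_excursionWeight hQ hirr hg, ← excursionProb_eq hQ hirr hg,
      green_of_mem Q _ (Set.mem_range_self (1 - ε)), if_neg (hg.ne hne), ENNReal.toReal_zero, sub_zero,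
      excursionRate]
  split_ifs with h
  · -- the entries of `u Q` add up to zero, and all but two of them vanish
    have hsum : ∑ k, Matrix.vecMul (excursionWeight Q g ε) Q k = 0 := by
      simp only [Matrix.vecMul, dotProduct]
      rw [Finset.sum_comm]
      simp [← Finset.mul_sum, hQ.row_sum]
    have hne : g ε ≠ g (1 - ε) := hg.ne (by fin_cases ε <;> decide)
    rw [← Finset.sum_subset (Finset.subset_univ {g ε, g (1 - ε)}) fun k _ hk => ?_,
      Finset.sum_pair hne, hother] at hsum
    · rw [h]; linarith
    · refine vecMul_excursionWeight_of_notMem hQ hirr hg ε ?_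
      rintro ⟨e, rfl⟩
      obtain rfl | rfl : e = ε ∨ e = 1 - ε := by fin_cases e <;> fin_cases ε <;> simp
      · simp at hk
      · simp at hk
  · obtain rfl : ε' = 1 - ε := by
      revert h; fin_cases ε <;> fin_cases ε' <;> simp
    exact hother

/-- If no excursion from `g ε` ended in the other distinguished state, `excursionWeight Q g ε` would
be a nonnegative null vector of `Q` with a zero entry. -/
theorem excursionRate_pos (ε : Fin 2) : 0 < excursionRate Q g ε (1 - ε) := by
  refine lt_of_le_of_ne (excursionRate_nonneg hQ _ _) fun h => ?_
  have hnull : Matrix.vecMul (excursionWeight Q g ε) Q = 0 := by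
    ext k
    by_cases hk : k ∈ Set.range g
    · obtain ⟨e, rfl⟩ := hk
      rw [vecMul_excursionWeight_apply hQ hirr hg, ← h]
      simp
    · exact vecMul_excursionWeight_of_notMem hQ hirr hg ε hk
  have hne : 1 - ε ≠ ε := by fin_cases ε <;> decide
  have h1 := hQ.eq_zero_of_apply_eq_zero hirr (excursionWeight_nonneg hQ hirr hg ε) hnull
    (k := g (1 - ε)) (by rw [excursionWeight_apply hQ hirr hg, if_neg hne]) (g ε)
  rw [excursionWeight_apply hQ hirr hg, if_pos rfl] at h1
  exact one_ne_zero h1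

/-- A vector is determined by its values at the two distinguished states and by being annihilated
by `Q` off these states. -/
theorem eq_excursionWeight_iff (ρ : V → ℝ) :
    (∀ k ∉ Set.range g, Matrix.vecMul ρ Q k = 0) ↔
      ∀ k ∉ Set.range g, ρ k = ρ (g 0) * excursionWeight Q g 0 k +
        ρ (g 1) * excursionWeight Q g 1 k := by
  set σ : V → ℝ := ρ (g 0) • excursionWeight Q g 0 + ρ (g 1) • excursionWeight Q g 1 with hσ
  have hσg : ∀ k ∈ Set.range g, ρ k = σ k := by
    rintro _ ⟨e, rfl⟩
    obtain rfl | rfl : e = 0 ∨ e = 1 := by fin_cases e <;> simp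
    · simp [hσ, excursionWeight_apply hQ hirr hg]
    · simp [hσ, excursionWeight_apply hQ hirr hg]
  have hσQ : ∀ k ∉ Set.range g, Matrix.vecMul σ Q k = 0 := by
    intro k hk
    simp [hσ, Matrix.add_vecMul, Matrix.smul_vecMul,
      vecMul_excursionWeight_of_notMem hQ hirr hg _ hk]
  constructor
  · intro h k _
    have h0 : ρ - σ = 0 := hQ.eq_zero_of_vecMul hirr (Set.range_nonempty g)
      (fun i hi => by rw [Pi.sub_apply, hσg i hi, sub_self])
      fun k hk => by rw [Matrix.sub_vecMul, Pi.sub_apply, h k hk, hσQ k hk, sub_self]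
    exact congrFun (sub_eq_zero.1 h0) k
  · intro h k hk
    have : ρ = σ := by
      ext i
      by_cases hi : i ∈ Set.range g
      · exact hσg i hi
      · exact h i hi
    rw [this]
    exact hσQ k hk

/-- The net flow into a distinguished state. -/
theorem vecMul_apply_of_eq_excursionWeight {ρ : V → ℝ}
    (h : ∀ k ∉ Set.range g, Matrix.vecMul ρ Q k = 0) :
    Matrix.vecMul ρ Q (g 0) =
        ρ (g 1) * excursionRate Q g 1 0 - ρ (g 0) * excursionRate Q g 0 1 ∧
      Matrix.vecMul ρ Q (g 1) =
        ρ (g 0) * excursionRate Q g 0 1 - ρ (g 1) * excursionRate Q g 1 0 := by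
  have h1 := (eq_excursionWeight_iff hQ hirr hg ρ).1 h
  have : ρ = ρ (g 0) • excursionWeight Q g 0 + ρ (g 1) • excursionWeight Q g 1 := by
    ext k
    by_cases hk : k ∈ Set.range g
    · obtain ⟨e, rfl⟩ := hk
      obtain rfl | rfl : e = 0 ∨ e = 1 := by fin_cases e <;> simp
      · simp [excursionWeight_apply hQ hirr hg]
      · simp [excursionWeight_apply hQ hirr hg]
    · exact h1 k hk
  have h2 : ∀ e, Matrix.vecMul ρ Q (g e) =
      ρ (g 0) * Matrix.vecMul (excursionWeight Q g 0) Q (g e) +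
        ρ (g 1) * Matrix.vecMul (excursionWeight Q g 1) Q (g e) := by
    intro e
    conv_lhs => rw [this]
    simp [Matrix.add_vecMul, Matrix.smul_vecMul]
  rw [h2, h2]
  simp only [vecMul_excursionWeight_apply hQ hirr hg]
  constructor <;> simp <;> ring

end

end Excursion

/-! ### The glued rate matrix and its linear system -/

section Gluing

variable {SA SB : Type*} [Fintype SA] [Fintype SB]
  (QA : Matrix (SA ⊕ Fin 2) (SA ⊕ Fin 2) ℝ) (QB : Matrix (Fin 2 ⊕ SB) (Fin 2 ⊕ SB) ℝ)
  (ρ : SA ⊕ Fin 2 ⊕ SB → ℝ)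

theorem vecMul_glue_inl (i : SA) : Matrix.vecMul ρ (glue QA QB) (Sum.inl i) =
    Matrix.vecMul (Sum.elim (ρ ∘ Sum.inl) (ρ ∘ Sum.inr ∘ Sum.inl)) QA (Sum.inl i) := by
  simp [Matrix.vecMul, dotProduct, glue]

theorem vecMul_glue_inr_inr (j : SB) : Matrix.vecMul ρ (glue QA QB) (Sum.inr (Sum.inr j)) =
    Matrix.vecMul (ρ ∘ Sum.inr) QB (Sum.inr j) := by
  simp [Matrix.vecMul, dotProduct, glue]

theorem vecMul_glue_inr_inl (e : Fin 2) : Matrix.vecMul ρ (glue QA QB) (Sum.inr (Sum.inl e)) =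
    Matrix.vecMul (Sum.elim (ρ ∘ Sum.inl) (ρ ∘ Sum.inr ∘ Sum.inl)) QA (Sum.inr e) +
      Matrix.vecMul (ρ ∘ Sum.inr) QB (Sum.inl e) := by
  simp [Matrix.vecMul, dotProduct, glue]
  ring

end Gluing

section LinearSystem

variable {SA SB : Type*} [Fintype SA] [Fintype SB]

/-- Once the weights at the two shared states are fixed up to a factor by the balance equation, the
normalization determines the solution. -/
theorem linearSystem_iff {v w : SA → ℝ} {x y : SB → ℝ} {a b D : ℝ}
    (hD : D = b * (∑ i, v i + ∑ j, x j + 1) + a * (∑ i, w i + ∑ j, y j + 1)) (hD0 : 0 < D)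
    (hb : 0 < b) (ρ : SA ⊕ Fin 2 ⊕ SB → ℝ) :
    ((∀ i, ρ (Sum.inl i) = ρ (Sum.inr (Sum.inl 0)) * v i + ρ (Sum.inr (Sum.inl 1)) * w i) ∧
      (∀ j, ρ (Sum.inr (Sum.inr j))
        = ρ (Sum.inr (Sum.inl 0)) * x j + ρ (Sum.inr (Sum.inl 1)) * y j) ∧
      a * ρ (Sum.inr (Sum.inl 0)) = b * ρ (Sum.inr (Sum.inl 1)) ∧ ∑ k, ρ k = 1) ↔
    ρ = Sum.elim (fun i => b / D * v i + a / D * w i)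
      (Sum.elim ![b / D, a / D] fun j => b / D * x j + a / D * y j) := by
  constructor
  · rintro ⟨h1, h2, h3, h4⟩
    rw [Fintype.sum_sum_type, Fintype.sum_sum_type, Fin.sum_univ_two] at h4
    simp_rw [h1, h2, Finset.sum_add_distrib, ← Finset.mul_sum] at h4
    have e0 : ρ (Sum.inr (Sum.inl 0)) = b / D := by
      rw [eq_div_iff hD0.ne', hD]
      linear_combination b * h4 + (∑ i, w i + ∑ j, y j + 1) * h3
    have e1 : ρ (Sum.inr (Sum.inl 1)) = a / D := by
      have : b * ρ (Sum.inr (Sum.inl 1)) = b * (a / D) := by rw [← h3, e0]; ring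
      exact mul_left_cancel₀ hb.ne' this
    ext (i | e | j)
    · simp [h1, e0, e1]
    · fin_cases e
      · simpa using e0
      · simpa using e1
    · simp [h2, e0, e1]
  · rintro rfl
    refine ⟨fun i => by simp, fun j => by simp, by simp; ring, ?_⟩
    rw [Fintype.sum_sum_type, Fintype.sum_sum_type, Fin.sum_univ_two]
    simp only [Sum.elim_inl, Sum.elim_inr, Finset.sum_add_distrib, ← Finset.mul_sum,
      Matrix.cons_val_zero, Matrix.cons_val_one]
    have := hD0.ne'
    field_simp
    rw [hD]
    ring

end LinearSystem

end MarkovGluing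

theorem theorem1 {SA SB : Type*}
    [Fintype SA] [DecidableEq SA] [MeasurableSpace SA] [MeasurableSingletonClass SA]
    [Fintype SB] [DecidableEq SB] [MeasurableSpace SB] [MeasurableSingletonClass SB]
    (QA : Matrix (SA ⊕ Fin 2) (SA ⊕ Fin 2) ℝ) (QB : Matrix (Fin 2 ⊕ SB) (Fin 2 ⊕ SB) ℝ)
    (hQA : MarkovGluing.IsRateMatrix QA) (hQB : MarkovGluing.IsRateMatrix QB)
    (hA : MarkovGluing.IsIrreducible QA) (hB : MarkovGluing.IsIrreducible QB)
    (qA qB : Fin 2 → Fin 2 → ℝ)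
    (hqA : qA = MarkovGluing.excursionRate QA Sum.inr)
    (hqB : qB = MarkovGluing.excursionRate QB Sum.inl)
    (v w : SA → ℝ) (x y : SB → ℝ)
    (hv : v = fun i => MarkovGluing.excursionWeight QA Sum.inr 0 (Sum.inl i))
    (hw : w = fun i => MarkovGluing.excursionWeight QA Sum.inr 1 (Sum.inl i))
    (hx : x = fun j => MarkovGluing.excursionWeight QB Sum.inl 0 (Sum.inr j))
    (hy : y = fun j => MarkovGluing.excursionWeight QB Sum.inl 1 (Sum.inr j))
    (D : ℝ)
    (hD : D = (qA 1 0 + qB 1 0) * (∑ i, v i + ∑ j, x j + 1)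
      + (qA 0 1 + qB 0 1) * (∑ i, w i + ∑ j, y j + 1)) :
    -- the conditional expectations in the coefficients are finite
    (∀ ε ε' i, MarkovGluing.condOccupation QA Sum.inr ε ε' (Sum.inl i) ≠ ∞) ∧
    (∀ ε ε' j, MarkovGluing.condOccupation QB Sum.inl ε ε' (Sum.inr j) ≠ ∞) ∧
    ∃ π : SA ⊕ Fin 2 ⊕ SB → ℝ,
      -- `π` is the unique stationary distribution of the glued chain
      (∀ ρ, MarkovGluing.IsStationaryDistribution (MarkovGluing.glue QA QB) ρ ↔ ρ = π) ∧
      -- `π` is the unique solution of the linear system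
      (∀ ρ : SA ⊕ Fin 2 ⊕ SB → ℝ,
        ((∀ i, ρ (Sum.inl i) = ρ (Sum.inr (Sum.inl 0)) * v i + ρ (Sum.inr (Sum.inl 1)) * w i) ∧
          (∀ j, ρ (Sum.inr (Sum.inr j))
            = ρ (Sum.inr (Sum.inl 0)) * x j + ρ (Sum.inr (Sum.inl 1)) * y j) ∧
          (qA 0 1 + qB 0 1) * ρ (Sum.inr (Sum.inl 0))
            = (qA 1 0 + qB 1 0) * ρ (Sum.inr (Sum.inl 1)) ∧
          ∑ k, ρ k = 1) ↔ ρ = π) ∧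
      -- explicit formulas, with a positive denominator
      0 < D ∧
      π (Sum.inr (Sum.inl 0)) = (qA 1 0 + qB 1 0) / D ∧
      π (Sum.inr (Sum.inl 1)) = (qA 0 1 + qB 0 1) / D := by
  classical
  have gA : Function.Injective (Sum.inr : Fin 2 → SA ⊕ Fin 2) := Sum.inr_injective
  have gB : Function.Injective (Sum.inl : Fin 2 → Fin 2 ⊕ SB) := Sum.inl_injective
  have notA : ∀ k : SA ⊕ Fin 2, k ∉ Set.range Sum.inr ↔ ∃ i, k = Sum.inl i := by
    rintro (i | e) <;> simp
  have notB : ∀ k : Fin 2 ⊕ SB, k ∉ Set.range Sum.inl ↔ ∃ j, k = Sum.inr j := by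
    rintro (e | j) <;> simp
  have hv0 : ∀ i, 0 ≤ v i := fun i => by
    rw [hv]; exact MarkovGluing.excursionWeight_nonneg hQA hA gA 0 _
  have hw0 : ∀ i, 0 ≤ w i := fun i => by
    rw [hw]; exact MarkovGluing.excursionWeight_nonneg hQA hA gA 1 _
  have hx0 : ∀ j, 0 ≤ x j := fun j => by
    rw [hx]; exact MarkovGluing.excursionWeight_nonneg hQB hB gB 0 _
  have hy0 : ∀ j, 0 ≤ y j := fun j => by
    rw [hy]; exact MarkovGluing.excursionWeight_nonneg hQB hB gB 1 _
  have ha : 0 < qA 0 1 + qB 0 1 := by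
    rw [hqA, hqB]
    exact add_pos (MarkovGluing.excursionRate_pos hQA hA gA 0)
      (MarkovGluing.excursionRate_pos hQB hB gB 0)
  have hb : 0 < qA 1 0 + qB 1 0 := by
    rw [hqA, hqB]
    exact add_pos (MarkovGluing.excursionRate_pos hQA hA gA 1)
      (MarkovGluing.excursionRate_pos hQB hB gB 1)
  have hD0 : 0 < D := by
    have h1 : 0 ≤ ∑ i, v i := Finset.sum_nonneg fun i _ => hv0 i
    have h2 : 0 ≤ ∑ i, w i := Finset.sum_nonneg fun i _ => hw0 i
    have h3 : 0 ≤ ∑ j, x j := Finset.sum_nonneg fun j _ => hx0 j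
    have h4 : 0 ≤ ∑ j, y j := Finset.sum_nonneg fun j _ => hy0 j
    rw [hD]
    positivity
  have hsys := fun ρ => MarkovGluing.linearSystem_iff hD hD0 hb ρ
  set π : SA ⊕ Fin 2 ⊕ SB → ℝ := Sum.elim
    (fun i => (qA 1 0 + qB 1 0) / D * v i + (qA 0 1 + qB 0 1) / D * w i)
    (Sum.elim ![(qA 1 0 + qB 1 0) / D, (qA 0 1 + qB 0 1) / D]
      fun j => (qA 1 0 + qB 1 0) / D * x j + (qA 0 1 + qB 0 1) / D * y j) with hπ
  -- the stationarity equations of the glued chain are the equations of the linear system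
  have hnull : ∀ ρ : SA ⊕ Fin 2 ⊕ SB → ℝ, Matrix.vecMul ρ (MarkovGluing.glue QA QB) = 0 ↔
      (∀ i, ρ (Sum.inl i) = ρ (Sum.inr (Sum.inl 0)) * v i + ρ (Sum.inr (Sum.inl 1)) * w i) ∧
      (∀ j, ρ (Sum.inr (Sum.inr j))
        = ρ (Sum.inr (Sum.inl 0)) * x j + ρ (Sum.inr (Sum.inl 1)) * y j) ∧
      (qA 0 1 + qB 0 1) * ρ (Sum.inr (Sum.inl 0))
        = (qA 1 0 + qB 1 0) * ρ (Sum.inr (Sum.inl 1)) := by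
    intro ρ
    set ρA : SA ⊕ Fin 2 → ℝ := Sum.elim (ρ ∘ Sum.inl) (ρ ∘ Sum.inr ∘ Sum.inl) with hρA
    set ρB : Fin 2 ⊕ SB → ℝ := ρ ∘ Sum.inr with hρB
    have eA := MarkovGluing.eq_excursionWeight_iff hQA hA gA ρA
    have eB := MarkovGluing.eq_excursionWeight_iff hQB hB gB ρB
    have hflow := fun h h' => And.intro
      (MarkovGluing.vecMul_apply_of_eq_excursionWeight hQA hA gA (ρ := ρA) h)
      (MarkovGluing.vecMul_apply_of_eq_excursionWeight hQB hB gB (ρ := ρB) h')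
    simp only [notA, notB, forall_exists_index, forall_eq_apply_imp_iff] at eA eB hflow
    have hsplit : Matrix.vecMul ρ (MarkovGluing.glue QA QB) = 0 ↔
        (∀ i, Matrix.vecMul ρA QA (Sum.inl i) = 0) ∧ (∀ j, Matrix.vecMul ρB QB (Sum.inr j) = 0) ∧
        ∀ e, Matrix.vecMul ρA QA (Sum.inr e) + Matrix.vecMul ρB QB (Sum.inl e) = 0 := by
      rw [funext_iff, Sum.forall, Sum.forall]
      simp only [MarkovGluing.vecMul_glue_inl, MarkovGluing.vecMul_glue_inr_inr,
        MarkovGluing.vecMul_glue_inr_inl, Pi.zero_apply]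
      tauto
    have eA' : (∀ i, Matrix.vecMul ρA QA (Sum.inl i) = 0) ↔ ∀ i, ρ (Sum.inl i) =
        ρ (Sum.inr (Sum.inl 0)) * v i + ρ (Sum.inr (Sum.inl 1)) * w i := by
      rw [hv, hw]; exact eA
    have eB' : (∀ j, Matrix.vecMul ρB QB (Sum.inr j) = 0) ↔ ∀ j, ρ (Sum.inr (Sum.inr j)) =
        ρ (Sum.inr (Sum.inl 0)) * x j + ρ (Sum.inr (Sum.inl 1)) * y j := by
      rw [hx, hy]; exact eB
    rw [hsplit, ← eA', ← eB']
    refine and_congr_right fun h1 => and_congr_right fun h2 => ?_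
    obtain ⟨⟨a0, a1⟩, b0, b1⟩ := hflow h1 h2
    rw [Fin.forall_fin_two, a0, a1, b0, b1, hqA, hqB]
    change ρ (Sum.inr (Sum.inl 1)) * _ - ρ (Sum.inr (Sum.inl 0)) * _ +
      (ρ (Sum.inr (Sum.inl 1)) * _ - ρ (Sum.inr (Sum.inl 0)) * _) = 0 ∧
      ρ (Sum.inr (Sum.inl 0)) * _ - ρ (Sum.inr (Sum.inl 1)) * _ +
      (ρ (Sum.inr (Sum.inl 0)) * _ - ρ (Sum.inr (Sum.inl 1)) * _) = 0 ↔ _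
    constructor
    · rintro ⟨h, -⟩; linarith
    · intro h; constructor <;> linarith
  refine ⟨fun ε ε' i => MarkovGluing.condOccupation_ne_top hQA hA gA ε ε' _,
    fun ε ε' j => MarkovGluing.condOccupation_ne_top hQB hB gB ε ε' _, π, fun ρ => ?_, hsys, hD0,
    rfl, rfl⟩
  have hsys' : (Matrix.vecMul ρ (MarkovGluing.glue QA QB) = 0 ∧ ∑ k, ρ k = 1) ↔ ρ = π := by
    rw [hnull, ← hsys]
    tauto
  refine ⟨fun h => hsys'.1 ⟨h.vecMul_eq_zero, h.sum_eq_one⟩, fun h => ⟨?_, ?_, ?_⟩⟩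
  · rw [h]
    have h0 := div_pos hb hD0
    have h1 := div_pos ha hD0
    rintro (i | e | j)
    · exact add_nonneg (mul_nonneg h0.le (hv0 i)) (mul_nonneg h1.le (hw0 i))
    · fin_cases e
      · exact h0.le
      · exact h1.le
    · exact add_nonneg (mul_nonneg h0.le (hx0 j)) (mul_nonneg h1.le (hy0 j))
  · exact (hsys'.2 h).2
  · exact (hsys'.2 h).1
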